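/- Let $M$ be a $(2n+1)$-dimensional smooth manifold with a Riemannian metric $g$, Levi-Civita connection $\nabla$, and an almost paracontact paracomplex Riemannian structure $(\phi,\xi,\eta,g)$: a $(1,1)$-tensor field $\phi$, a vector field $\xi$ and a 1-form $\eta$, all smooth, with $$\phi^2=\mathrm{id}-\eta\otimes\xi,\quad \eta(\xi)=1,\quad g(x,\xi)=\eta(x),\quad g(\phi x,\phi y)=g(x,y)-\eta(x)\eta(y),$$ such that on $H=\ker\eta$ the eigenspaces of $\phi$ for $+1$ and $-1$ both have dimension $n$. Put $F(x,y,z)=g((\nabla_x\phi)y,z)$ and $\widetilde g(x,y)=g(x,\phi y)+\eta(x)\eta(y)$. Suppose that the structure is para-Sasaki-like, that is, for all smooth horizontal vector fields $X,Y,Z$ (those with values in $H$), $$F(X,Y,Z)=F(\xi,Y,Z)=F(\xi,\xi,Z)=0,\qquad F(X,Y,\xi)=-g(X,Y).$$ Then: a) The structure is normal, i.e. the almost paracomplex structure $\check P$ on $M\times\mathbb R^+$ given by $\check PX=\phi X$ for $X\in H$, $\check P\xi=r\,\partial_r$, $\check P\partial_r=\frac1r\xi$ is integrable (its Nijenhuis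 torsion vanishes), and $N=[\phi,\phi]-\mathrm d\eta\otimes\xi=0$, where $[\phi,\phi](x,y)=[\phi x,\phi y]+\phi^2[x,y]-\phi[\phi x,y]-\phi[x,\phi y]$ and $\mathrm d\eta(x,y)=x\,\eta(y)-y\,\eta(x)-\eta([x,y])$. It is paracontact, i.e. $2g(x,\phi y)=(\mathcal L_\xi g)(x,y)=(\nabla_x\eta)(y)+(\nabla_y\eta)(x)$ for all vector fields $x,y$; equivalently $\mathcal L_\xi g=2\widetilde g|_H$, where $\widetilde g|_H(x,y)=\widetilde g(x-\eta(x)\xi,\,y-\eta(y)\xi)$. Moreover $\mathrm d\eta=0$, $\nabla_\xi\xi=0$, and the integral curves of $\xi$ are geodesics. b) The Lee forms $\theta(z)=\sum_{i=1}^{2n}F(e_i,e_i,z)$ and $\theta^*(z)=\sum_{i=1}^{2n}F(e_i,\phi e_i,z)$, where $e_1,\dots,e_{2n}$ is any orthonormal basis of $H$ at the point considered, satisfy $\theta=-2n\,\eta$ and $\theta^*=0$. -/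

import Mathlib

open Bundle VectorField
open scoped Manifold ContDiff

namespace ParaSasaki

noncomputable section

set_option linter.unusedSectionVars false

section LeviCivita

variable {E : Type*} [NormedAddCommGroup E] [NormedSpace ℝ E]
  {H : Type*} [TopologicalSpace H] (I : ModelWithCorners ℝ E H)
  {M : Type*} [TopologicalSpace M] [ChartedSpace H M]

/-- The differential of a function in the direction of a vector field: `(X f)(p)`. -/
def dirDeriv (X : Π p : M, TangentSpace I p) (f : M → ℝ) (p : M) : ℝ :=
  mvfderiv I f p (X p)

variable [RiemannianBundle (fun p : M ↦ TangentSpace I p)]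

/-- The metric `g(X, Y)` of two vector fields, as a function on `M`. -/
def metric (X Y : Π p : M, TangentSpace I p) (p : M) : ℝ := inner ℝ (X p) (Y p)

lemma metric_comm (X Y : Π p : M, TangentSpace I p) : metric I X Y = metric I Y X := by
  ext q; simp [metric, real_inner_comm]

/-- Half of the right hand side of the Koszul formula. -/
def koszul (X Y Z : Π p : M, TangentSpace I p) (p : M) : ℝ :=
  (dirDeriv I X (metric I Y Z) p + dirDeriv I Y (metric I Z X) p - dirDeriv I Z (metric I X Y) p
    + metric I (mlieBracket I X Y) Z p + metric I (mlieBracket I Z X) Y p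
    + metric I (mlieBracket I Z Y) X p) / 2

variable [FiniteDimensional ℝ E] [IsManifold I ∞ M]
  [IsContMDiffRiemannianBundle I ∞ E (fun p : M ↦ TangentSpace I p)]

lemma mdiffAt_metric {X Y : Π p : M, TangentSpace I p} {p : M}
    (hX : MDiffAt (T% X) p) (hY : MDiffAt (T% Y) p) : MDiffAt (metric I X Y) p :=
  MDifferentiableAt.inner_bundle (IB := I) (F := E) (E := fun p : M ↦ TangentSpace I p) hX hY

lemma dirDeriv_metric_add_left {X Y Z : Π p : M, TangentSpace I p} (W : Π p : M, TangentSpace I p)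
    {p : M} (hX : MDiffAt (T% X) p) (hY : MDiffAt (T% Y) p) (hZ : MDiffAt (T% Z) p) :
    dirDeriv I W (metric I (X + Y) Z) p
      = dirDeriv I W (metric I X Z) p + dirDeriv I W (metric I Y Z) p := by
  have h : metric I (X + Y) Z = metric I X Z + metric I Y Z := by
    ext q; simp [metric, inner_add_left]
  simp [dirDeriv, h, mvfderiv_add (mdiffAt_metric I hX hZ) (mdiffAt_metric I hY hZ)]

lemma dirDeriv_metric_smul_left {X Z : Π p : M, TangentSpace I p} (W : Π p : M, TangentSpace I p)
    {f : M → ℝ} {p : M} (hf : MDiffAt f p) (hX : MDiffAt (T% X) p) (hZ : MDiffAt (T% Z) p) :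
    dirDeriv I W (metric I (f • X) Z) p
      = f p * dirDeriv I W (metric I X Z) p + dirDeriv I W f p * metric I X Z p := by
  have h : metric I (f • X) Z = f * metric I X Z := by
    ext q; simp [metric, inner_smul_left]
  simp [dirDeriv, h, mvfderiv_mul hf (mdiffAt_metric I hX hZ)]
  ring

lemma dirDeriv_metric_add_right {X Y Z : Π p : M, TangentSpace I p}
    (W : Π p : M, TangentSpace I p)
    {p : M} (hX : MDiffAt (T% X) p) (hY : MDiffAt (T% Y) p) (hZ : MDiffAt (T% Z) p) :
    dirDeriv I W (metric I Z (X + Y)) p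
      = dirDeriv I W (metric I Z X) p + dirDeriv I W (metric I Z Y) p := by
  rw [metric_comm, dirDeriv_metric_add_left I W hX hY hZ, metric_comm I X, metric_comm I Y]

lemma dirDeriv_metric_smul_right {X Z : Π p : M, TangentSpace I p}
    (W : Π p : M, TangentSpace I p)
    {f : M → ℝ} {p : M} (hf : MDiffAt f p) (hX : MDiffAt (T% X) p) (hZ : MDiffAt (T% Z) p) :
    dirDeriv I W (metric I Z (f • X)) p
      = f p * dirDeriv I W (metric I Z X) p + dirDeriv I W f p * metric I Z X p := by
  rw [metric_comm, dirDeriv_metric_smul_left I W hf hX hZ, metric_comm I X]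

lemma koszul_tensorial_left {Y : Π p : M, TangentSpace I p} {p : M} (hY : MDiffAt (T% Y) p)
    (Z : Π p : M, TangentSpace I p) (hZ : MDiffAt (T% Z) p) :
    TensorialAt I E (fun X ↦ koszul I X Y Z p) p where
  smul {f X} hf hX := by
    simp only [koszul, dirDeriv_metric_smul_left I _ hf hX hY,
      dirDeriv_metric_smul_right I _ hf hX hZ]
    simp only [metric, dirDeriv, mlieBracket_smul_left hf hX, mlieBracket_smul_right hf hX,
      inner_add_left, real_inner_smul_left, real_inner_smul_right, Pi.smul_apply',
      map_smul, smul_eq_mul]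
    rw [real_inner_comm (X p) (Z p)]
    ring
  add {X X'} hX hX' := by
    simp only [koszul, dirDeriv_metric_add_left I _ hX hX' hY,
      dirDeriv_metric_add_right I _ hX hX' hZ]
    simp only [metric, dirDeriv, mlieBracket_add_left hX hX', mlieBracket_add_right hX hX',
      inner_add_left, inner_add_right, Pi.add_apply, map_add]
    ring

lemma koszul_tensorial_right {Y : Π p : M, TangentSpace I p} {p : M} (hY : MDiffAt (T% Y) p)
    (X : Π p : M, TangentSpace I p) (hX : MDiffAt (T% X) p) :
    TensorialAt I E (fun Z ↦ koszul I X Y Z p) p where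
  smul {f Z} hf hZ := by
    simp only [koszul, dirDeriv_metric_smul_left I _ hf hZ hX,
      dirDeriv_metric_smul_right I _ hf hZ hY]
    simp only [metric, dirDeriv, mlieBracket_smul_left hf hZ,
      inner_add_left, real_inner_smul_left, real_inner_smul_right, Pi.smul_apply',
      map_smul, smul_eq_mul]
    rw [real_inner_comm (Y p) (Z p), real_inner_comm (X p) (Z p)]
    ring
  add {Z Z'} hZ hZ' := by
    simp only [koszul, dirDeriv_metric_add_left I _ hZ hZ' hX,
      dirDeriv_metric_add_right I _ hZ hZ' hY]
    simp only [metric, dirDeriv, mlieBracket_add_left hZ hZ',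
      inner_add_left, inner_add_right, Pi.add_apply, map_add]
    ring

/-- The functional `(u, w) ↦ g(∇_u Y, w)` on `T_p M` given by the Koszul formula. -/
def koszulForm (Y : Π p : M, TangentSpace I p) (p : M) (hY : MDiffAt (T% Y) p) :
    TangentSpace I p →L[ℝ] TangentSpace I p →L[ℝ] ℝ :=
  TensorialAt.mkHom₂ (fun X Z ↦ koszul I X Y Z p) p
    (fun Z hZ ↦ koszul_tensorial_left I hY Z hZ) (fun X hX ↦ koszul_tensorial_right I hY X hX)

lemma koszulForm_apply {X Y Z : Π p : M, TangentSpace I p} {p : M} (hX : MDiffAt (T% X) p)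
    (hY : MDiffAt (T% Y) p) (hZ : MDiffAt (T% Z) p) :
    koszulForm I Y p hY (X p) (Z p) = koszul I X Y Z p :=
  TensorialAt.mkHom₂_apply (Φ := fun X Z ↦ koszul I X Y Z p) _ _ hX hZ

instance (p : M) : FiniteDimensional ℝ (TangentSpace I p) :=
  inferInstanceAs (FiniteDimensional ℝ E)

instance (p : M) : CompleteSpace (TangentSpace I p) := FiniteDimensional.complete ℝ _

/-- The vector of `T_p M` that represents a linear functional with respect to the metric. -/
def sharp (p : M) : (TangentSpace I p →L[ℝ] ℝ) →ₗ[ℝ] TangentSpace I p where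
  toFun α := (InnerProductSpace.toDual ℝ (TangentSpace I p)).symm α
  map_add' := by simp
  map_smul' := by simp

lemma inner_sharp (p : M) (α : TangentSpace I p →L[ℝ] ℝ) (w : TangentSpace I p) :
    inner ℝ (sharp I p α) w = α w := by
  simp [sharp]

open Classical in
/-- `u ↦ ∇_u Y` at the point `p`. -/
def nablaAt (Y : Π p : M, TangentSpace I p) (p : M) : TangentSpace I p →L[ℝ] TangentSpace I p :=
  if hY : MDiffAt (T% Y) p then
    LinearMap.toContinuousLinearMap (sharp I p ∘ₗ
      { toFun u := koszulForm I Y p hY u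
        map_add' := by simp
        map_smul' := by simp })
  else 0

lemma inner_nablaAt {X Y Z : Π p : M, TangentSpace I p} {p : M} (hX : MDiffAt (T% X) p)
    (hY : MDiffAt (T% Y) p) (hZ : MDiffAt (T% Z) p) :
    inner ℝ (nablaAt I Y p (X p)) (Z p) = koszul I X Y Z p := by
  simp [nablaAt, hY, inner_sharp, koszulForm_apply I hX hY hZ]


/-- Two linear maps on `T_p M` agree if they have the same metric coefficients. -/
lemma clm_ext_of_inner {p : M} {A B : TangentSpace I p →L[ℝ] TangentSpace I p}
    (h : ∀ X Z : Π q : M, TangentSpace I q, MDiffAt (T% X) p → MDiffAt (T% Z) p →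
      inner ℝ (A (X p)) (Z p) = inner ℝ (B (X p)) (Z p)) : A = B := by
  ext1 u
  refine ext_inner_right ℝ fun w ↦ ?_
  have := h (FiberBundle.extend E u) (FiberBundle.extend E w)
    (FiberBundle.mdifferentiableAt_extend ..) (FiberBundle.mdifferentiableAt_extend ..)
  simpa using this

/-- The Levi-Civita connection of the metric: for `Y` differentiable at `p`, `∇_X Y` is determined
at `p` by the Koszul formula. On paper, `leviCivita I Y p (X p)` is `(∇_X Y)(p)`. -/
def leviCivita : CovariantDerivative I E (TangentSpace I : M → Type _) where
  toFun := nablaAt I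
  isCovariantDerivativeOnUniv :=
    { add := by
        intro Y Y' p hY hY' _
        refine clm_ext_of_inner I fun X Z hX hZ ↦ ?_
        have hS : MDiffAt (T% (Y + Y')) p := mdifferentiableAt_add_section hY hY'
        rw [add_apply, inner_add_left, inner_nablaAt I hX hS hZ,
          inner_nablaAt I hX hY hZ, inner_nablaAt I hX hY' hZ]
        simp only [koszul, dirDeriv_metric_add_left I _ hY hY' hZ,
          dirDeriv_metric_add_right I _ hY hY' hX]
        simp only [metric, dirDeriv, mlieBracket_add_right hY hY',
          inner_add_left, inner_add_right, Pi.add_apply, map_add]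
        ring
      leibniz := by
        intro Y f p hY hf _
        refine clm_ext_of_inner I fun X Z hX hZ ↦ ?_
        have hS : MDiffAt (T% (f • Y)) p := hf.smul_section hY
        rw [inner_nablaAt I hX hS hZ]
        simp only [add_apply, smul_apply, inner_add_left,
          real_inner_smul_left, inner_nablaAt I hX hY hZ, ContinuousLinearMap.smulRight_apply]
        simp only [koszul, dirDeriv_metric_smul_left I _ hf hY hZ,
          dirDeriv_metric_smul_right I _ hf hY hX]
        simp only [metric, dirDeriv, mlieBracket_smul_right hf hY,
          inner_add_left, real_inner_smul_left, real_inner_smul_right,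
          Pi.smul_apply', map_smul, smul_eq_mul]
        rw [real_inner_comm (X p) (Y p)]
        ring }

/-- `∇_X Y` for the Levi-Civita connection, as a vector field. -/
def nabla (X Y : Π p : M, TangentSpace I p) : Π p : M, TangentSpace I p :=
  fun p ↦ leviCivita I Y p (X p)

/-- The Koszul formula. -/
lemma inner_leviCivita {X Y Z : Π p : M, TangentSpace I p} {p : M} (hX : MDiffAt (T% X) p)
    (hY : MDiffAt (T% Y) p) (hZ : MDiffAt (T% Z) p) :
    inner ℝ (leviCivita I Y p (X p)) (Z p) = koszul I X Y Z p :=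
  inner_nablaAt I hX hY hZ

/-- The Levi-Civita connection is metric. -/
theorem leviCivita_metric {X Y Z : Π p : M, TangentSpace I p} {p : M} (hX : MDiffAt (T% X) p)
    (hY : MDiffAt (T% Y) p) (hZ : MDiffAt (T% Z) p) :
    dirDeriv I X (metric I Y Z) p
      = inner ℝ (leviCivita I Y p (X p)) (Z p) + inner ℝ (Y p) (leviCivita I Z p (X p)) := by
  have h1 := inner_leviCivita I hX hY hZ
  have h2 := inner_leviCivita I hX hZ hY
  rw [real_inner_comm] at h2
  rw [h1, h2]
  have h4 : metric I (mlieBracket I Z Y) X p = - metric I (mlieBracket I Y Z) X p := by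
    simp only [metric, mlieBracket_swap_apply (V := Z) (W := Y), inner_neg_left]
  have h5 : metric I (mlieBracket I Z X) Y p = - metric I (mlieBracket I X Z) Y p := by
    simp only [metric, mlieBracket_swap_apply (V := Z) (W := X), inner_neg_left]
  have h6 : metric I (mlieBracket I Y X) Z p = - metric I (mlieBracket I X Y) Z p := by
    simp only [metric, mlieBracket_swap_apply (V := Y) (W := X), inner_neg_left]
  simp only [koszul, metric_comm I Z Y, metric_comm I X Y, metric_comm I Z X, h4, h5, h6]
  ring

/-- The Levi-Civita connection is torsion free. -/
theorem leviCivita_torsion :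
    (leviCivita I : CovariantDerivative I E (TangentSpace I : M → Type _)).torsion = 0 := by
  rw [CovariantDerivative.torsion_eq_zero_iff]
  intro X Y p hX hY
  refine ext_inner_right ℝ fun w ↦ ?_
  have hZ := FiberBundle.mdifferentiableAt_extend (I := I) E (V := fun q : M ↦ TangentSpace I q) w
  have h1 := inner_leviCivita I hX hY hZ
  have h2 := inner_leviCivita I hY hX hZ
  rw [FiberBundle.extend_apply_self] at h1 h2
  rw [inner_sub_left, h1, h2]
  set Z := FiberBundle.extend E w with hZdef
  have h6 : metric I (mlieBracket I Y X) Z p = - metric I (mlieBracket I X Y) Z p := by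
    simp only [metric, mlieBracket_swap_apply (V := Y) (W := X), inner_neg_left]
  have h7 : inner ℝ (mlieBracket I X Y p) w = metric I (mlieBracket I X Y) Z p := by
    simp [metric, hZdef]
  simp only [h7, koszul, metric_comm I Z Y, metric_comm I Y X, metric_comm I Z X, h6]
  ring


/-- The velocity `γ'(t)` of a curve. -/
def velocity (γ : ℝ → M) (t : ℝ) : TangentSpace I (γ t) :=
  mfderiv 𝓘(ℝ, ℝ) I γ t (1 : ℝ)

/-- The covariant derivative at time `t` of a vector field `W` along the curve `γ`. In the local
frame `(E_i)` of the tangent bundle given by the trivialization at `γ t`, with `W = ∑ w_i E_i`,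
this is `∑ w_i'(t) E_i + ∑ w_i(t) ∇_{γ'(t)} E_i`; the field `∑ w_i(t) E_i` with frozen coefficients
is `FiberBundle.extend E (W t)`. -/
def covDerivAlong (γ : ℝ → M) (W : Π t : ℝ, TangentSpace I (γ t)) (t : ℝ) : TangentSpace I (γ t) :=
  letI τ := trivializationAt E (TangentSpace I) (γ t)
  τ.symm (γ t) (deriv (fun s ↦ (τ ⟨γ s, W s⟩).2) t)
    + leviCivita I (FiberBundle.extend E (W t)) (γ t) (velocity I γ t)

/-- A curve is a geodesic on `s` if its velocity is differentiable there, as a curve in the tangent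
bundle, and its acceleration `∇_{γ'} γ'` vanishes there. -/
def IsGeodesicOn (γ : ℝ → M) (s : Set ℝ) : Prop :=
  ∀ t ∈ s, MDifferentiableAt 𝓘(ℝ, ℝ) I.tangent
      (fun r ↦ (⟨γ r, velocity I γ r⟩ : TangentBundle I M)) t ∧
    covDerivAlong I γ (velocity I γ) t = 0

end LeviCivita
section Structures

variable {E : Type*} [NormedAddCommGroup E] [NormedSpace ℝ E]
  {H : Type*} [TopologicalSpace H] (I : ModelWithCorners ℝ E H)
  {M : Type*} [TopologicalSpace M] [ChartedSpace H M] [IsManifold I ∞ M]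

/-- The smooth vector fields on `M`. -/
def IsSmoothField (X : Π p : M, TangentSpace I p) : Prop :=
  ContMDiff I I.tangent ∞ (fun p ↦ (⟨p, X p⟩ : TangentBundle I M))

/-- The Nijenhuis torsion `[P, P](X, Y) = [PX, PY] + P²[X, Y] - P[PX, Y] - P[X, PY]` of a field `P`
of endomorphisms of the tangent spaces. -/
def nijenhuisTorsion (P : Π p : M, TangentSpace I p →L[ℝ] TangentSpace I p)
    (X Y : Π p : M, TangentSpace I p) (p : M) : TangentSpace I p :=
  mlieBracket I (fun q ↦ P q (X q)) (fun q ↦ P q (Y q)) p + P p (P p (mlieBracket I X Y p))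
    - P p (mlieBracket I (fun q ↦ P q (X q)) Y p) - P p (mlieBracket I X (fun q ↦ P q (Y q)) p)

/-- An almost paracomplex structure is integrable if its Nijenhuis torsion vanishes. -/
def IsIntegrable (P : Π p : M, TangentSpace I p →L[ℝ] TangentSpace I p) : Prop :=
  ∀ X Y : Π p : M, TangentSpace I p, IsSmoothField I X → IsSmoothField I Y →
    ∀ p, nijenhuisTorsion I P X Y p = 0

/-- The half line `r > 0`, as an open submanifold of the line. -/
def posReals : TopologicalSpace.Opens ℝ := ⟨Set.Ioi 0, isOpen_Ioi⟩

variable [RiemannianBundle (fun p : M ↦ TangentSpace I p)]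

variable (M) in
/-- An almost paracontact paracomplex Riemannian structure `(φ, ξ, η, g)` on `M`, where `g` is the
Riemannian metric of `M`: the eigenspaces of `φ` on `H = ker η` for `1` and `-1` both have
dimension `n`. -/
structure ApcpcrStructure (n : ℕ) where
  φ : Π p : M, TangentSpace I p →L[ℝ] TangentSpace I p
  ξ : Π p : M, TangentSpace I p
  η : Π p : M, TangentSpace I p →L[ℝ] ℝ
  smooth_φ : ContMDiff I (I.prod 𝓘(ℝ, E →L[ℝ] E)) ∞
    (fun p ↦ TotalSpace.mk' (E →L[ℝ] E)
      (E := fun p : M ↦ TangentSpace I p →L[ℝ] TangentSpace I p) p (φ p))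
  smooth_ξ : IsSmoothField I ξ
  smooth_η : ContMDiff I (I.prod 𝓘(ℝ, E →L[ℝ] ℝ)) ∞
    (fun p ↦ TotalSpace.mk' (E →L[ℝ] ℝ) (E := fun p : M ↦ TangentSpace I p →L[ℝ] ℝ) p (η p))
  φ_φ : ∀ p v, φ p (φ p v) = v - η p v • ξ p
  η_ξ : ∀ p, η p (ξ p) = 1
  finrank_pos : ∀ p, Module.finrank ℝ
    ↥((η p).toLinearMap.ker ⊓ Module.End.eigenspace (φ p).toLinearMap 1) = n
  finrank_neg : ∀ p, Module.finrank ℝ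
    ↥((η p).toLinearMap.ker ⊓ Module.End.eigenspace (φ p).toLinearMap (-1)) = n
  g_ξ : ∀ p (v : TangentSpace I p), inner ℝ v (ξ p) = η p v
  g_φ : ∀ p (v w : TangentSpace I p), inner ℝ (φ p v) (φ p w) = inner ℝ v w - η p v * η p w

namespace ApcpcrStructure

variable {I} {n : ℕ} (S : ApcpcrStructure I M n)

/-- The vector field `φ X`. -/
def phi (X : Π p : M, TangentSpace I p) : Π p : M, TangentSpace I p := fun p ↦ S.φ p (X p)

/-- The function `η(X)`. -/
def eta (X : Π p : M, TangentSpace I p) : M → ℝ := fun p ↦ S.η p (X p)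

/-- Horizontal vector fields: those with values in `H = ker η`. -/
def IsHorizontal (X : Π p : M, TangentSpace I p) : Prop := ∀ p, S.η p (X p) = 0

/-- The horizontal part `X - η(X) ξ` of a vector field. -/
def hor (X : Π p : M, TangentSpace I p) : Π p : M, TangentSpace I p :=
  fun p ↦ X p - S.η p (X p) • S.ξ p

/-- The associated metric `g̃(X, Y) = g(X, φ Y) + η(X) η(Y)`. -/
def assocMetric (X Y : Π p : M, TangentSpace I p) (p : M) : ℝ :=
  metric I X (S.phi Y) p + S.eta X p * S.eta Y p

/-- The exterior derivative `dη(X, Y) = X η(Y) - Y η(X) - η([X, Y])`. -/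
def dEta (X Y : Π p : M, TangentSpace I p) (p : M) : ℝ :=
  dirDeriv I X (S.eta Y) p - dirDeriv I Y (S.eta X) p - S.η p (mlieBracket I X Y p)

/-- The Lie derivative `(L_ξ g)(X, Y) = ξ g(X, Y) - g([ξ, X], Y) - g(X, [ξ, Y])`. -/
def lieDerivMetric (X Y : Π p : M, TangentSpace I p) (p : M) : ℝ :=
  dirDeriv I S.ξ (metric I X Y) p - metric I (mlieBracket I S.ξ X) Y p
    - metric I X (mlieBracket I S.ξ Y) p

/-- The Nijenhuis tensor `N = [φ, φ] - dη ⊗ ξ`. -/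
def nijenhuis (X Y : Π p : M, TangentSpace I p) (p : M) : TangentSpace I p :=
  nijenhuisTorsion I S.φ X Y p - S.dEta X Y p • S.ξ p

/-- The almost paracomplex structure `P̌` on `M × ℝ⁺`, determined by `P̌ X = φ X` for horizontal `X`,
`P̌ ξ = r ∂_r` and `P̌ ∂_r = r⁻¹ ξ`: it maps `v + a ∂_r` to `φ v + a r⁻¹ ξ + r η(v) ∂_r`.
Tangent vectors of the product at `(p, r)` are pairs of a tangent vector at `p` and a number. -/
def cone (q : M × posReals) :
    TangentSpace (I.prod 𝓘(ℝ, ℝ)) q →L[ℝ] TangentSpace (I.prod 𝓘(ℝ, ℝ)) q :=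
  letI φ : E →L[ℝ] E := S.φ q.1
  letI ξ : E := S.ξ q.1
  letI η : E →L[ℝ] ℝ := S.η q.1
  letI r : ℝ := q.2
  letI P : E × ℝ →L[ℝ] E × ℝ :=
    (φ ∘L ContinuousLinearMap.fst ℝ E ℝ
        + (r⁻¹ • ContinuousLinearMap.snd ℝ E ℝ).smulRight ξ).prod
      (r • (η ∘L ContinuousLinearMap.fst ℝ E ℝ))
  P

/-- The structure is normal if the almost paracomplex structure `P̌` on `M × ℝ⁺` is integrable. -/
def IsNormal : Prop := IsIntegrable (I.prod 𝓘(ℝ, ℝ)) S.cone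

variable [FiniteDimensional ℝ E]
  [IsContMDiffRiemannianBundle I ∞ E (fun p : M ↦ TangentSpace I p)]

/-- `(∇_X η)(Y) = X η(Y) - η(∇_X Y)`. -/
def nablaEta (X Y : Π p : M, TangentSpace I p) (p : M) : ℝ :=
  dirDeriv I X (S.eta Y) p - S.eta (nabla I X Y) p

/-- `(∇_X φ) Y = ∇_X (φ Y) - φ (∇_X Y)`. -/
def nablaPhi (X Y : Π p : M, TangentSpace I p) : Π p : M, TangentSpace I p :=
  nabla I X (S.phi Y) - S.phi (nabla I X Y)

/-- The structure tensor `F(X, Y, Z) = g((∇_X φ) Y, Z)`. -/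
def F (X Y Z : Π p : M, TangentSpace I p) (p : M) : ℝ := metric I (S.nablaPhi X Y) Z p

/-- The paracontact condition `2 g(X, φ Y) = (L_ξ g)(X, Y) = (∇_X η)(Y) + (∇_Y η)(X)`. -/
def IsParacontact : Prop :=
  ∀ X Y : Π p : M, TangentSpace I p, IsSmoothField I X → IsSmoothField I Y → ∀ p,
    2 * metric I X (S.phi Y) p = S.lieDerivMetric X Y p ∧
    S.lieDerivMetric X Y p = S.nablaEta X Y p + S.nablaEta Y X p

/-- Para-Sasaki-like: `F(X, Y, Z) = F(ξ, Y, Z) = F(ξ, ξ, Z) = 0` and `F(X, Y, ξ) = -g(X, Y)` for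
smooth horizontal vector fields `X`, `Y`, `Z`. -/
def IsParaSasakiLike : Prop :=
  ∀ X Y Z : Π p : M, TangentSpace I p, IsSmoothField I X → IsSmoothField I Y → IsSmoothField I Z →
    S.IsHorizontal X → S.IsHorizontal Y → S.IsHorizontal Z → ∀ p,
      S.F X Y Z p = 0 ∧ S.F S.ξ Y Z p = 0 ∧ S.F S.ξ S.ξ Z p = 0 ∧
      S.F X Y S.ξ p = - metric I X Y p

/-- The smooth vector fields `e_1, …, e_{2n}` form at `p` an orthonormal basis of `H_p`
(which has dimension `2n`). -/
def IsHorizontalFrameAt (e : Fin (2 * n) → Π p : M, TangentSpace I p) (p : M) : Prop :=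
  (∀ i, IsSmoothField I (e i)) ∧ Orthonormal ℝ (fun i ↦ e i p) ∧ ∀ i, S.η p (e i p) = 0

/-- The Lee form `θ(Z) = ∑ F(e_i, e_i, Z)`. -/
def theta (e : Fin (2 * n) → Π p : M, TangentSpace I p) (Z : Π p : M, TangentSpace I p)
    (p : M) : ℝ := ∑ i, S.F (e i) (e i) Z p

/-- The Lee form `θ*(Z) = ∑ F(e_i, φ e_i, Z)`. -/
def thetaStar (e : Fin (2 * n) → Π p : M, TangentSpace I p) (Z : Π p : M, TangentSpace I p)
    (p : M) : ℝ := ∑ i, S.F (e i) (S.phi (e i)) Z p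

end ApcpcrStructure

end Structures

end
end ParaSasaki

/-!
The defining conditions of a para-Sasaki-like structure prescribe `F = g((∇φ) ·, ·)` on horizontal
arguments and for some of the arguments equal to `ξ`. Since `∇φ` is a tensor, every tangent vector at
a point extends to a global smooth field (`exists_horizontal_eq`), and `∇_u φ` is symmetric because
`φ` is (`inner_nablaPhiTensor_comm`), they determine `∇φ` completely (`nablaPhiTensor_eq`):
`(∇_u φ) v = - g(h u, h v) ξ - η(v) h u`, where `h v = v - η(v) ξ`.

For `v = ξ` this gives `∇_u ξ = φ u` (`nabla_ξ_eq`). As `φ` is symmetric and `∇` is metric and torsion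
free, it follows that `(∇_X η)(Y) = g(X, φ Y)`, `dη = 0`, `L_ξ g = 2 g(·, φ ·)` and `∇_ξ ξ = φ ξ = 0`,
while `[φ, φ]`, an alternating sum of values of `∇φ`, vanishes
(`nijenhuisTorsion_φ_eq_zero`). The acceleration of an integral curve of `ξ` is `∇_ξ ξ`
(`isGeodesicOn_of_isMIntegralCurveOn`).

The Nijenhuis torsion of `P̌` on `M × ℝ⁺` is a tensor too, so it is enough to evaluate it on lifts of
vector fields of `M` and on `∂_r` (`isNormal`). Brackets of such fields are computed componentwise
(`mlieBracket_prodField`), and the components of the torsion are expressed by `N`, by `dη` and by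
`[φ X, ξ] - φ [X, ξ]`, which all vanish.

The Lee forms are read off from the formula for `∇φ`; `θ*` is a multiple of the trace of `φ`, which is
zero because the eigenspaces of `φ` on `H` for `1` and `-1` have equal dimensions (`trace_φ`).
-/

namespace ParaSasaki

noncomputable section

set_option linter.unusedSectionVars false

/-! ### Algebra of the structure on a tangent space -/

namespace ApcpcrStructure

section Pointwise

variable {E : Type*} [NormedAddCommGroup E] [NormedSpace ℝ E]
  {H : Type*} [TopologicalSpace H] {I : ModelWithCorners ℝ E H}
  {M : Type*} [TopologicalSpace M] [ChartedSpace H M] [IsManifold I ∞ M]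
  [RiemannianBundle (fun p : M ↦ TangentSpace I p)]
  {n : ℕ} (S : ApcpcrStructure I M n)

lemma inner_ξ_left (p : M) (v : TangentSpace I p) : inner ℝ (S.ξ p) v = S.η p v := by
  rw [real_inner_comm, S.g_ξ]

/-- `φ ξ` has norm `g(ξ, ξ) - η(ξ)² = 0`. -/
lemma φ_ξ (p : M) : S.φ p (S.ξ p) = 0 := by
  rw [← inner_self_eq_zero (𝕜 := ℝ), S.g_φ, S.g_ξ, S.η_ξ]
  norm_num

/-- Apply `φ² = id - η ⊗ ξ` to `φ v`: since `φ³ = φ`, the term `η(φ v) ξ` vanishes. -/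
lemma η_φ (p : M) (v : TangentSpace I p) : S.η p (S.φ p v) = 0 := by
  have h : S.φ p (S.φ p (S.φ p v)) = S.φ p v := by
    rw [S.φ_φ p v, map_sub, map_smul, S.φ_ξ, smul_zero, sub_zero]
  rw [S.φ_φ, sub_eq_self] at h
  simpa [S.η_ξ] using congrArg (S.η p) h

lemma inner_φ_left (p : M) (v w : TangentSpace I p) :
    inner ℝ (S.φ p v) w = inner ℝ v (S.φ p w) := by
  have h := S.g_φ p (S.φ p v) w
  rw [S.φ_φ, S.η_φ, zero_mul, sub_zero] at h
  rw [← h, inner_sub_left, real_inner_smul_left, S.inner_ξ_left, S.η_φ, mul_zero, sub_zero]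

lemma φ_φ_φ (p : M) (v : TangentSpace I p) : S.φ p (S.φ p (S.φ p v)) = S.φ p v := by
  rw [S.φ_φ, S.η_φ, zero_smul, sub_zero]

/-- The horizontal part `v - η(v) ξ` of a tangent vector. -/
def horVec (p : M) (v : TangentSpace I p) : TangentSpace I p := v - S.η p v • S.ξ p

lemma horVec_add (p : M) (v : TangentSpace I p) : S.horVec p v + S.η p v • S.ξ p = v :=
  sub_add_cancel _ _

lemma η_horVec (p : M) (v : TangentSpace I p) : S.η p (S.horVec p v) = 0 := by
  simp [horVec, S.η_ξ]

lemma horVec_of_η_eq_zero {p : M} {v : TangentSpace I p} (h : S.η p v = 0) :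
    S.horVec p v = v := by
  simp [horVec, h]

lemma horVec_ξ (p : M) : S.horVec p (S.ξ p) = 0 := by
  simp [horVec, S.η_ξ]

lemma φ_horVec (p : M) (v : TangentSpace I p) : S.φ p (S.horVec p v) = S.φ p v := by
  simp [horVec, S.φ_ξ]

/-- `φ` is the difference of the projections `(φ² + φ) / 2` and `(φ² - φ) / 2` onto its horizontal
eigenspaces for `1` and `-1`, which have the same dimension. -/
lemma trace_φ [FiniteDimensional ℝ E] (p : M) :
    LinearMap.trace ℝ (TangentSpace I p) (S.φ p).toLinearMap = 0 := by
  set T := TangentSpace I p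
  let f : T →ₗ[ℝ] T := (S.φ p).toLinearMap
  have hproj : ∀ ε : ℝ, ε * ε = 1 →
      LinearMap.IsProj ((S.η p).toLinearMap.ker ⊓ Module.End.eigenspace f ε)
        ((2⁻¹ : ℝ) • (f ∘ₗ f + ε • f)) := by
    intro ε hε
    refine ⟨fun v ↦ ?_, fun v hv ↦ ?_⟩
    · refine ⟨?_, ?_⟩
      · simp [f, S.η_φ]
      · rw [SetLike.mem_coe, Module.End.mem_eigenspace_iff]
        simp only [f, LinearMap.smul_apply, LinearMap.add_apply, LinearMap.comp_apply,
          ContinuousLinearMap.coe_coe, map_smul, map_add, S.φ_φ_φ, smul_add, smul_smul]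
        rw [mul_left_comm ε, hε, mul_one, mul_comm ε, add_comm]
    · obtain ⟨h1, h2⟩ := hv
      rw [SetLike.mem_coe, Module.End.mem_eigenspace_iff] at h2
      simp only [LinearMap.smul_apply, LinearMap.add_apply, LinearMap.comp_apply, h2, map_smul,
        smul_smul, hε]
      rw [← two_smul ℝ, smul_smul]
      norm_num
  have h1 := (hproj 1 (by norm_num)).trace
  have h2 := (hproj (-1) (by norm_num)).trace
  have e1 : Module.finrank ℝ ↥((S.η p).toLinearMap.ker ⊓ Module.End.eigenspace f 1) = n :=
    S.finrank_pos p
  have e2 : Module.finrank ℝ ↥((S.η p).toLinearMap.ker ⊓ Module.End.eigenspace f (-1)) = n :=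
    S.finrank_neg p
  rw [e1] at h1
  rw [e2] at h2
  simp only [map_smul, map_add, smul_eq_mul] at h1 h2
  change LinearMap.trace ℝ T f = 0
  linarith

/-- Together with `ξ`, which contributes `g(ξ, φ ξ) = 0`, the `e i` form an orthonormal basis of the
tangent space, so the sum is the trace of `φ`. -/
lemma sum_inner_φ_of_orthonormal [FiniteDimensional ℝ E]
    (hE : Module.finrank ℝ E = 2 * n + 1) {p : M} {e : Fin (2 * n) → TangentSpace I p}
    (he : Orthonormal ℝ e) (hη : ∀ i, S.η p (e i) = 0) :
    ∑ i, inner ℝ (e i) (S.φ p (e i)) = (0 : ℝ) := by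
  let v : Option (Fin (2 * n)) → TangentSpace I p := fun o ↦ o.elim (S.ξ p) e
  have hv : Orthonormal ℝ v := by
    classical
    rw [orthonormal_iff_ite] at he ⊢
    rintro (_ | i) (_ | j)
    · simp only [v, Option.elim, S.g_ξ, S.η_ξ, if_true]
    · simp [v, S.inner_ξ_left, hη]
    · simp [v, S.g_ξ, hη]
    · simp [v, he]
  have hcard : Fintype.card (Option (Fin (2 * n))) = Module.finrank ℝ (TangentSpace I p) := by
    rw [Fintype.card_option, Fintype.card_fin]
    exact hE.symm
  let b := basisOfOrthonormalOfCardEqFinrank hv hcard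
  have hb : ⇑b = v := coe_basisOfOrthonormalOfCardEqFinrank hv hcard
  let ob := b.toOrthonormalBasis (by rwa [hb])
  have hob : ⇑ob = v := by simp [ob, hb]
  have h := LinearMap.trace_eq_sum_inner (S.φ p).toLinearMap ob
  rw [S.trace_φ, hob] at h
  simpa [v, Fintype.sum_option, S.φ_ξ] using h.symm

end Pointwise
end ApcpcrStructure

/-! ### Smooth extensions and differentiability -/

section Extension

variable {E : Type*} [NormedAddCommGroup E] [NormedSpace ℝ E]
  {H : Type*} [TopologicalSpace H] {I : ModelWithCorners ℝ E H}
  {M : Type*} [TopologicalSpace M] [ChartedSpace H M] [IsManifold I ∞ M]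

lemma IsSmoothField.mdiffAt {X : Π p : M, TangentSpace I p} (hX : IsSmoothField I X) (p : M) :
    MDiffAt (T% X) p :=
  (hX p).mdifferentiableAt (by simp)

lemma exists_isSmoothField_eq [FiniteDimensional ℝ E] [T2Space M] {p : M} (v : TangentSpace I p) :
    ∃ X : Π q : M, TangentSpace I q, IsSmoothField I X ∧ X p = v := by
  obtain ⟨s, hs, hX⟩ := FiberBundle.exists_contMDiffOn_extend (k := ∞) I E
    (V := fun q : M ↦ TangentSpace I q) v
  obtain ⟨u, hus, hu, hpu⟩ := mem_nhds_iff.1 hs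
  obtain ⟨f, -, hf⟩ := (SmoothBumpFunction.nhds_basis_tsupport (I := I) p).mem_iff.1
    (hu.mem_nhds hpu)
  refine ⟨(f : M → ℝ) • FiberBundle.extend E v, ?_, by simp⟩
  exact ContMDiffOn.smul_section_of_tsupport (I := I) (F := E) (n := ∞)
    (V := fun q : M ↦ TangentSpace I q) (s := FiberBundle.extend E v) (u := u)
    (f.contMDiff.contMDiffOn) hu hf (hX.mono hus)

end Extension

namespace ApcpcrStructure

section Differentiability

variable {E : Type*} [NormedAddCommGroup E] [NormedSpace ℝ E]
  {H : Type*} [TopologicalSpace H] {I : ModelWithCorners ℝ E H}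
  {M : Type*} [TopologicalSpace M] [ChartedSpace H M] [IsManifold I ∞ M]
  [RiemannianBundle (fun p : M ↦ TangentSpace I p)]
  {n : ℕ} (S : ApcpcrStructure I M n)

section Pullback

variable {E' : Type*} [NormedAddCommGroup E'] [NormedSpace ℝ E']
  {H' : Type*} [TopologicalSpace H'] {I' : ModelWithCorners ℝ E' H'}
  {N : Type*} [TopologicalSpace N] [ChartedSpace H' N]

/-- `φ` maps a differentiable vector field along `b` to a differentiable one. -/
lemma mdiffAt_φ_comp {b : N → M} {v : Π q : N, TangentSpace I (b q)} {q : N}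
    (hb : MDifferentiableAt I' I b q)
    (hv : MDifferentiableAt I' I.tangent (fun q ↦ (⟨b q, v q⟩ : TangentBundle I M)) q) :
    MDifferentiableAt I' I.tangent (fun q ↦ (⟨b q, S.φ (b q) (v q)⟩ : TangentBundle I M)) q :=
  MDifferentiableAt.clm_bundle_apply (F₁ := E) (F₂ := E) (IB := I)
    (E₁ := fun p : M ↦ TangentSpace I p) (E₂ := fun p : M ↦ TangentSpace I p)
    (((S.smooth_φ (b q)).mdifferentiableAt (by simp)).comp q hb) hv

variable [FiniteDimensional ℝ E]
  [IsContMDiffRiemannianBundle I ∞ E (fun p : M ↦ TangentSpace I p)]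

lemma mdiffAt_η_comp {b : N → M} {v : Π q : N, TangentSpace I (b q)} {q : N}
    (hb : MDifferentiableAt I' I b q)
    (hv : MDifferentiableAt I' I.tangent (fun q ↦ (⟨b q, v q⟩ : TangentBundle I M)) q) :
    MDifferentiableAt I' 𝓘(ℝ, ℝ) (fun q ↦ S.η (b q) (v q)) q := by
  have h := MDifferentiableAt.inner_bundle (IB := I) (F := E) (E := fun p : M ↦ TangentSpace I p)
    hv ((S.smooth_ξ.mdiffAt (b q)).comp q hb)
  simpa only [S.g_ξ] using h

end Pullback

variable [FiniteDimensional ℝ E]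
  [IsContMDiffRiemannianBundle I ∞ E (fun p : M ↦ TangentSpace I p)]

lemma mdiffAt_ξ (p : M) : MDiffAt (T% S.ξ) p := S.smooth_ξ.mdiffAt p

lemma mdiffAt_phi {X : Π p : M, TangentSpace I p} {p : M} (hX : MDiffAt (T% X) p) :
    MDiffAt (T% (S.phi X)) p :=
  S.mdiffAt_φ_comp mdifferentiableAt_id hX

lemma mdiffAt_eta {X : Π p : M, TangentSpace I p} {p : M} (hX : MDiffAt (T% X) p) :
    MDiffAt (S.eta X) p :=
  S.mdiffAt_η_comp mdifferentiableAt_id hX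

lemma isSmoothField_hor {X : Π p : M, TangentSpace I p} (hX : IsSmoothField I X) :
    IsSmoothField I (S.hor X) := by
  have h1 : ContMDiff I 𝓘(ℝ, ℝ) ∞ (S.eta X) := by
    have h := ContMDiff.inner_bundle (IB := I) (F := E) (E := fun p : M ↦ TangentSpace I p)
      hX S.smooth_ξ
    simp only [S.g_ξ] at h
    exact h
  exact ContMDiff.sub_section hX (h1.smul_section S.smooth_ξ)

/-- The para-Sasaki-like condition speaks of global horizontal fields; their values fill up
`H = ker η`. -/
lemma exists_horizontal_eq [T2Space M] {p : M} {v : TangentSpace I p} (hv : S.η p v = 0) :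
    ∃ X : Π q : M, TangentSpace I q, IsSmoothField I X ∧ S.IsHorizontal X ∧ X p = v := by
  obtain ⟨X, hX, rfl⟩ := exists_isSmoothField_eq v
  exact ⟨S.hor X, S.isSmoothField_hor hX, fun q ↦ S.η_horVec q (X q),
    S.horVec_of_η_eq_zero hv⟩

end Differentiability
end ApcpcrStructure

/-! ### The tensor `∇φ` -/

section CovariantDerivativePhi

variable {E : Type*} [NormedAddCommGroup E] [NormedSpace ℝ E]
  {H : Type*} [TopologicalSpace H] {I : ModelWithCorners ℝ E H}
  {M : Type*} [TopologicalSpace M] [ChartedSpace H M] [IsManifold I ∞ M]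
  [RiemannianBundle (fun p : M ↦ TangentSpace I p)]
  [FiniteDimensional ℝ E]
  [IsContMDiffRiemannianBundle I ∞ E (fun p : M ↦ TangentSpace I p)]

/-- The derivative of `g(Y, Z)` along a vector `u` at `p`. -/
lemma mvfderiv_metric {Y Z : Π p : M, TangentSpace I p} {p : M} (u : TangentSpace I p)
    (hY : MDiffAt (T% Y) p) (hZ : MDiffAt (T% Z) p) :
    mvfderiv I (metric I Y Z) p u
      = inner ℝ (leviCivita I Y p u) (Z p) + inner ℝ (Y p) (leviCivita I Z p u) := by
  have hX := FiberBundle.mdifferentiableAt_extend (I := I) E (V := fun q : M ↦ TangentSpace I q) u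
  have h := leviCivita_metric I hX hY hZ
  simpa [dirDeriv] using h

/-- The Levi-Civita connection is torsion free: `[X, Y] = ∇_X Y - ∇_Y X`. -/
lemma mlieBracket_eq_sub {X Y : Π p : M, TangentSpace I p} {p : M}
    (hX : MDiffAt (T% X) p) (hY : MDiffAt (T% Y) p) :
    mlieBracket I X Y p = leviCivita I Y p (X p) - leviCivita I X p (Y p) :=
  ((CovariantDerivative.torsion_eq_zero_iff _).1 (leviCivita_torsion I) hX hY).symm

namespace ApcpcrStructure

variable {n : ℕ} (S : ApcpcrStructure I M n)

lemma tensorialAt_nablaPhi (p : M) :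
    TensorialAt I E (fun Y : Π q : M, TangentSpace I q ↦
      leviCivita I (S.phi Y) p - S.φ p ∘L leviCivita I Y p) p where
  smul {f Y} hf hY := by
    have e : S.phi (f • Y) = f • S.phi Y := by
      funext q; simp [phi]
    rw [e, (leviCivita I).isCovariantDerivativeOn.leibniz (s := Set.univ) (S.mdiffAt_phi hY) hf,
      (leviCivita I).isCovariantDerivativeOn.leibniz (s := Set.univ) hY hf]
    ext u
    simp [phi, smul_sub]
  add {Y Y'} hY hY' := by
    have e : S.phi (Y + Y') = S.phi Y + S.phi Y' := by
      funext q; simp [phi]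
    rw [e, (leviCivita I).isCovariantDerivativeOn.add (s := Set.univ) (S.mdiffAt_phi hY)
      (S.mdiffAt_phi hY'), (leviCivita I).isCovariantDerivativeOn.add (s := Set.univ) hY hY']
    ext u
    simp
    abel

/-- The tensor `∇φ` at `p`, with arguments `v`, `u` in this order: `(∇_u φ) v`. -/
def nablaPhiTensor (p : M) :
    TangentSpace I p →L[ℝ] TangentSpace I p →L[ℝ] TangentSpace I p :=
  TensorialAt.mkHom _ p (S.tensorialAt_nablaPhi p)

lemma nablaPhiTensor_apply {Y : Π q : M, TangentSpace I q} {p : M} (hY : MDiffAt (T% Y) p)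
    (u : TangentSpace I p) :
    S.nablaPhiTensor p (Y p) u = leviCivita I (S.phi Y) p u - S.φ p (leviCivita I Y p u) := by
  have h := TensorialAt.mkHom_apply (S.tensorialAt_nablaPhi p) hY
  exact congrArg (fun A : TangentSpace I p →L[ℝ] TangentSpace I p ↦ A u) h

lemma F_eq_inner {X Y Z : Π q : M, TangentSpace I q} {p : M} (hY : MDiffAt (T% Y) p) :
    S.F X Y Z p = inner ℝ (S.nablaPhiTensor p (Y p) (X p)) (Z p) := by
  rw [S.nablaPhiTensor_apply hY]
  rfl

/-- `∇_u φ` is symmetric, since `φ` is. -/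
lemma inner_nablaPhiTensor_comm (p : M) (u v w : TangentSpace I p) :
    inner ℝ (S.nablaPhiTensor p v u) w = inner ℝ (S.nablaPhiTensor p w u) v := by
  have ext := fun x : TangentSpace I p ↦ FiberBundle.mdifferentiableAt_extend (I := I) E
    (V := fun q : M ↦ TangentSpace I q) x
  set Y : Π q : M, TangentSpace I q := FiberBundle.extend E v with hYdef
  set Z : Π q : M, TangentSpace I q := FiberBundle.extend E w with hZdef
  have hY : MDiffAt (T% Y) p := ext v
  have hZ : MDiffAt (T% Z) p := ext w
  have hYp : Y p = v := FiberBundle.extend_apply_self ..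
  have hZp : Z p = w := FiberBundle.extend_apply_self ..
  have h1 := mvfderiv_metric u (S.mdiffAt_phi hY) hZ
  have h2 := mvfderiv_metric u hY (S.mdiffAt_phi hZ)
  have e : metric I (S.phi Y) Z = metric I Y (S.phi Z) := by
    funext q; exact S.inner_φ_left q _ _
  have e1 := S.nablaPhiTensor_apply hY u
  have e2 := S.nablaPhiTensor_apply hZ u
  rw [hYp] at e1
  rw [hZp] at e2
  rw [e1, e2, inner_sub_left, inner_sub_left]
  rw [e, h2] at h1
  simp only [phi, hYp, hZp] at h1
  have h3 := S.inner_φ_left p v (leviCivita I Z p u)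
  have h4 := S.inner_φ_left p (leviCivita I Y p u) w
  rw [phi, hYp, hZp] at *
  rw [real_inner_comm v, real_inner_comm v]
  linarith

/-- `ξ` has constant length. -/
lemma inner_nabla_ξ (p : M) (u : TangentSpace I p) :
    inner ℝ (leviCivita I S.ξ p u) (S.ξ p) = (0 : ℝ) := by
  have h := mvfderiv_metric u (S.mdiffAt_ξ p) (S.mdiffAt_ξ p)
  have e : metric I S.ξ S.ξ = fun _ ↦ (1 : ℝ) := by
    funext q; exact (S.g_ξ q _).trans (S.η_ξ q)
  rw [e, real_inner_comm _ (S.ξ p)] at h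
  have h0 : mvfderiv I (fun _ : M ↦ (1 : ℝ)) p u = 0 := by simp [mvfderiv_const]
  linarith

lemma nablaPhiTensor_ξ (p : M) (u : TangentSpace I p) :
    S.nablaPhiTensor p (S.ξ p) u = - S.φ p (leviCivita I S.ξ p u) := by
  rw [S.nablaPhiTensor_apply (S.mdiffAt_ξ p)]
  have e : S.phi S.ξ = 0 := by funext q; exact S.φ_ξ q
  rw [e, (leviCivita I).zero]
  simp

end ApcpcrStructure

end CovariantDerivativePhi

/-! ### Consequences of the para-Sasaki-like condition on `M` -/

section ParaSasakiLike

variable {E : Type*} [NormedAddCommGroup E] [NormedSpace ℝ E]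
  {H : Type*} [TopologicalSpace H] {I : ModelWithCorners ℝ E H}
  {M : Type*} [TopologicalSpace M] [ChartedSpace H M] [IsManifold I ∞ M]
  [RiemannianBundle (fun p : M ↦ TangentSpace I p)]
  [FiniteDimensional ℝ E]
  [IsContMDiffRiemannianBundle I ∞ E (fun p : M ↦ TangentSpace I p)]

namespace ApcpcrStructure

variable {n : ℕ} {S : ApcpcrStructure I M n}

namespace IsParaSasakiLike

variable [T2Space M]

/-- The hypothesis, as a condition on the tensor `∇φ` at a point. -/
lemma inner_nablaPhiTensor_of_horizontal (hS : S.IsParaSasakiLike) (p : M)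
    {u v w : TangentSpace I p} (hu : S.η p u = 0) (hv : S.η p v = 0) (hw : S.η p w = 0) :
    inner ℝ (S.nablaPhiTensor p v u) w = (0 : ℝ) ∧
    inner ℝ (S.nablaPhiTensor p v (S.ξ p)) w = (0 : ℝ) ∧
    inner ℝ (S.nablaPhiTensor p (S.ξ p) (S.ξ p)) w = (0 : ℝ) ∧
    inner ℝ (S.nablaPhiTensor p v u) (S.ξ p) = - (inner ℝ u v : ℝ) := by
  obtain ⟨X, hX, hXH, rfl⟩ := S.exists_horizontal_eq hu
  obtain ⟨Y, hY, hYH, rfl⟩ := S.exists_horizontal_eq hv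
  obtain ⟨Z, hZ, hZH, rfl⟩ := S.exists_horizontal_eq hw
  obtain ⟨h1, h2, h3, h4⟩ := hS X Y Z hX hY hZ hXH hYH hZH p
  rw [S.F_eq_inner (hY.mdiffAt p)] at h1 h2 h4
  rw [S.F_eq_inner (S.mdiffAt_ξ p)] at h3
  exact ⟨h1, h2, h3, h4⟩

/-- The hypothesis determines `∇φ`:
`(∇_u φ) v = - g(h u, h v) ξ - η(v) h u`, with `h` the horizontal part. -/
lemma nablaPhiTensor_eq (hS : S.IsParaSasakiLike) (p : M) (u v : TangentSpace I p) :
    S.nablaPhiTensor p v u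
      = - (inner ℝ (S.horVec p u) (S.horVec p v) : ℝ) • S.ξ p - S.η p v • S.horVec p u := by
  have key : ∀ w, inner ℝ (S.nablaPhiTensor p v u) w
      = - (inner ℝ (S.horVec p u) (S.horVec p v) : ℝ) * S.η p w
        - S.η p v * inner ℝ (S.horVec p u) (S.horVec p w) := by
    intro w
    have hu := S.η_horVec p u
    have hv := S.η_horVec p v
    have hw := S.η_horVec p w
    obtain ⟨a1, a2, a3, a4⟩ := hS.inner_nablaPhiTensor_of_horizontal p hu hv hw
    obtain ⟨-, -, c3, b4⟩ := hS.inner_nablaPhiTensor_of_horizontal p hu hw hv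
    -- the values of `F(u, ξ, w)` and `F(ξ, v, ξ)` are not prescribed: they follow by symmetry
    have b4' := S.inner_nablaPhiTensor_comm p (S.horVec p u) (S.ξ p) (S.horVec p w)
    have c3' := S.inner_nablaPhiTensor_comm p (S.ξ p) (S.ξ p) (S.horVec p v)
    have d : ∀ x, inner ℝ (S.nablaPhiTensor p (S.ξ p) x) (S.ξ p) = (0 : ℝ) := fun x ↦ by
      rw [S.nablaPhiTensor_ξ, inner_neg_left, S.g_ξ, S.η_φ, neg_zero]
    conv_lhs =>
      rw [← S.horVec_add p u, ← S.horVec_add p v, ← S.horVec_add p w]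
    simp only [map_add, map_smul, add_apply, smul_apply,
      inner_add_left, inner_add_right, real_inner_smul_left, real_inner_smul_right,
      a1, a2, a3, a4, d, b4', b4, ← c3', c3]
    ring
  refine ext_inner_right ℝ fun w ↦ ?_
  rw [key, inner_sub_left, real_inner_smul_left, real_inner_smul_left, S.inner_ξ_left,
    ← S.horVec_add p w, inner_add_right, real_inner_smul_right, S.g_ξ, S.η_horVec p u,
    S.horVec_add]
  ring

/-- `∇_u ξ = φ u`: the formula for `(∇_u φ) ξ = -φ(∇_u ξ)` gives `φ(∇_u ξ)`, and `∇_u ξ` is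
horizontal. -/
lemma nabla_ξ_eq (hS : S.IsParaSasakiLike) (p : M) (u : TangentSpace I p) :
    leviCivita I S.ξ p u = S.φ p u := by
  have h := hS.nablaPhiTensor_eq p u (S.ξ p)
  rw [S.nablaPhiTensor_ξ, S.horVec_ξ, S.η_ξ, inner_zero_right, neg_zero, zero_smul, zero_sub,
    one_smul, neg_inj] at h
  have h2 := congrArg (S.φ p) h
  rw [S.φ_φ, S.φ_horVec, ← S.g_ξ, S.inner_nabla_ξ, zero_smul, sub_zero] at h2
  exact h2

lemma nabla_phi_eq (hS : S.IsParaSasakiLike) {Y : Π q : M, TangentSpace I q} {p : M}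
    (hY : MDiffAt (T% Y) p) (u : TangentSpace I p) :
    leviCivita I (S.phi Y) p u = S.φ p (leviCivita I Y p u)
      - (inner ℝ (S.horVec p u) (S.horVec p (Y p)) : ℝ) • S.ξ p - S.η p (Y p) • S.horVec p u := by
  have h := hS.nablaPhiTensor_eq p u (Y p)
  rw [S.nablaPhiTensor_apply hY, sub_eq_iff_eq_add] at h
  rw [h, neg_smul]
  abel

lemma mvfderiv_eta_eq (hS : S.IsParaSasakiLike) {Y : Π q : M, TangentSpace I q} {p : M}
    (hY : MDiffAt (T% Y) p) (u : TangentSpace I p) :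
    mvfderiv I (S.eta Y) p u = S.η p (leviCivita I Y p u) + inner ℝ (Y p) (S.φ p u) := by
  have e : S.eta Y = metric I Y S.ξ := by funext q; exact (S.g_ξ q _).symm
  rw [e, mvfderiv_metric u hY (S.mdiffAt_ξ p), S.g_ξ, hS.nabla_ξ_eq]

lemma nablaEta_eq (hS : S.IsParaSasakiLike) {X Y : Π q : M, TangentSpace I q} {p : M}
    (hY : MDiffAt (T% Y) p) : S.nablaEta X Y p = metric I X (S.phi Y) p := by
  rw [nablaEta, dirDeriv, hS.mvfderiv_eta_eq hY, metric, phi, ← S.inner_φ_left,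
    real_inner_comm (X p)]
  exact add_sub_cancel_left _ _

/-- `dη` is the skew part of `∇η`, and `(∇_X η)(Y) = g(X, φ Y)` is symmetric. -/
lemma dEta_eq_zero (hS : S.IsParaSasakiLike) {X Y : Π q : M, TangentSpace I q} {p : M}
    (hX : MDiffAt (T% X) p) (hY : MDiffAt (T% Y) p) : S.dEta X Y p = 0 := by
  rw [dEta, dirDeriv, dirDeriv, hS.mvfderiv_eta_eq hX, hS.mvfderiv_eta_eq hY,
    mlieBracket_eq_sub hX hY, map_sub, ← S.inner_φ_left p (X p), real_inner_comm (Y p)]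
  ring

lemma lieDerivMetric_eq (hS : S.IsParaSasakiLike) {X Y : Π q : M, TangentSpace I q} {p : M}
    (hX : MDiffAt (T% X) p) (hY : MDiffAt (T% Y) p) :
    S.lieDerivMetric X Y p = 2 * metric I X (S.phi Y) p := by
  have hξ := S.mdiffAt_ξ p
  rw [lieDerivMetric, dirDeriv, mvfderiv_metric _ hX hY, metric, metric, metric,
    mlieBracket_eq_sub hξ hX, mlieBracket_eq_sub hξ hY, inner_sub_left, inner_sub_right,
    hS.nabla_ξ_eq, hS.nabla_ξ_eq, S.inner_φ_left, phi]
  ring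

lemma isParacontact (hS : S.IsParaSasakiLike) : S.IsParacontact := by
  intro X Y hX hY p
  have e : metric I Y (S.phi X) p = metric I X (S.phi Y) p := by
    rw [metric, metric, phi, ← S.inner_φ_left, real_inner_comm, phi]
  rw [hS.lieDerivMetric_eq (hX.mdiffAt p) (hY.mdiffAt p), hS.nablaEta_eq (hX.mdiffAt p),
    hS.nablaEta_eq (hY.mdiffAt p), e]
  exact ⟨rfl, by ring⟩

lemma lieDerivMetric_eq_assocMetric (hS : S.IsParaSasakiLike) {X Y : Π q : M, TangentSpace I q}
    {p : M} (hX : MDiffAt (T% X) p) (hY : MDiffAt (T% Y) p) :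
    S.lieDerivMetric X Y p = 2 * S.assocMetric (S.hor X) (S.hor Y) p := by
  have h : S.assocMetric (S.hor X) (S.hor Y) p
      = inner ℝ (S.horVec p (X p)) (S.φ p (S.horVec p (Y p)))
        + S.η p (S.horVec p (X p)) * S.η p (S.horVec p (Y p)) := rfl
  rw [hS.lieDerivMetric_eq hX hY, h, S.η_horVec, zero_mul, add_zero, S.φ_horVec,
    ← S.inner_φ_left, S.φ_horVec, S.inner_φ_left]
  rfl

/-- With all brackets expressed by `∇`, the torsion is
`(∇_{φX} φ) Y - (∇_{φY} φ) X - φ (∇_X φ) Y + φ (∇_Y φ) X`, and the terms cancel by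
`nablaPhiTensor_eq`. -/
lemma nijenhuisTorsion_φ_eq_zero (hS : S.IsParaSasakiLike) {X Y : Π q : M, TangentSpace I q}
    {p : M} (hX : MDiffAt (T% X) p) (hY : MDiffAt (T% Y) p) :
    nijenhuisTorsion I S.φ X Y p = 0 := by
  have h1 : mlieBracket I (fun q ↦ S.φ q (X q)) (fun q ↦ S.φ q (Y q)) p
      = leviCivita I (S.phi Y) p (S.φ p (X p)) - leviCivita I (S.phi X) p (S.φ p (Y p)) :=
    mlieBracket_eq_sub (S.mdiffAt_phi hX) (S.mdiffAt_phi hY)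
  have h2 : mlieBracket I (fun q ↦ S.φ q (X q)) Y p
      = leviCivita I Y p (S.φ p (X p)) - leviCivita I (S.phi X) p (Y p) :=
    mlieBracket_eq_sub (S.mdiffAt_phi hX) hY
  have h3 : mlieBracket I X (fun q ↦ S.φ q (Y q)) p
      = leviCivita I (S.phi Y) p (X p) - leviCivita I X p (S.φ p (Y p)) :=
    mlieBracket_eq_sub hX (S.mdiffAt_phi hY)
  rw [nijenhuisTorsion, h1, h2, h3, mlieBracket_eq_sub hX hY]
  have hh : ∀ v, S.horVec p (S.φ p v) = S.φ p v := fun v ↦ S.horVec_of_η_eq_zero (S.η_φ p v)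
  have hsymm : inner ℝ (S.φ p (X p)) (S.horVec p (Y p))
      = (inner ℝ (S.φ p (Y p)) (S.horVec p (X p)) : ℝ) := by
    rw [S.inner_φ_left, S.inner_φ_left, S.φ_horVec, S.φ_horVec, ← S.inner_φ_left, real_inner_comm]
  simp only [hS.nabla_phi_eq hX, hS.nabla_phi_eq hY, map_sub, map_smul, S.φ_ξ, S.φ_horVec, hh,
    hsymm, smul_zero]
  abel

lemma nijenhuis_eq_zero (hS : S.IsParaSasakiLike) {X Y : Π q : M, TangentSpace I q}
    {p : M} (hX : MDiffAt (T% X) p) (hY : MDiffAt (T% Y) p) :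
    S.nijenhuis X Y p = 0 := by
  rw [nijenhuis, hS.nijenhuisTorsion_φ_eq_zero hX hY, hS.dEta_eq_zero hX hY, zero_smul, sub_zero]

lemma nabla_ξ_ξ (hS : S.IsParaSasakiLike) (p : M) : nabla I S.ξ S.ξ p = 0 :=
  (hS.nabla_ξ_eq p _).trans (S.φ_ξ p)

lemma theta_eq (hS : S.IsParaSasakiLike) {p : M} {e : Fin (2 * n) → Π q : M, TangentSpace I q}
    (he : S.IsHorizontalFrameAt e p) (Z : Π q : M, TangentSpace I q) :
    S.theta e Z p = -2 * (n : ℝ) * S.eta Z p := by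
  obtain ⟨hsm, hon, hη⟩ := he
  have h : ∀ i, S.F (e i) (e i) Z p = - S.eta Z p := fun i ↦ by
    have h1 : inner ℝ (e i p) (e i p) = (1 : ℝ) := by
      rw [real_inner_self_eq_norm_sq, hon.1 i, one_pow]
    rw [S.F_eq_inner ((hsm i).mdiffAt p), hS.nablaPhiTensor_eq, hη i,
      S.horVec_of_η_eq_zero (hη i), h1, zero_smul, sub_zero, real_inner_smul_left, S.inner_ξ_left,
      neg_one_mul, eta]
  simp only [theta, h, Finset.sum_const, Finset.card_univ, Fintype.card_fin, nsmul_eq_mul]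
  push_cast
  ring

lemma thetaStar_eq_zero (hS : S.IsParaSasakiLike) (hE : Module.finrank ℝ E = 2 * n + 1) {p : M}
    {e : Fin (2 * n) → Π q : M, TangentSpace I q}
    (he : S.IsHorizontalFrameAt e p) (Z : Π q : M, TangentSpace I q) :
    S.thetaStar e Z p = 0 := by
  obtain ⟨hsm, hon, hη⟩ := he
  have h : ∀ i, S.F (e i) (S.phi (e i)) Z p
      = - (inner ℝ (e i p) (S.φ p (e i p)) * S.eta Z p) := fun i ↦ by
    rw [S.F_eq_inner (S.mdiffAt_phi ((hsm i).mdiffAt p)), hS.nablaPhiTensor_eq, phi, S.η_φ,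
      S.horVec_of_η_eq_zero (hη i), S.horVec_of_η_eq_zero (S.η_φ p _), zero_smul, sub_zero,
      real_inner_smul_left, S.inner_ξ_left, neg_mul, eta]
  simp only [thetaStar, h, Finset.sum_neg_distrib, ← Finset.sum_mul]
  rw [S.sum_inner_φ_of_orthonormal hE hon hη, zero_mul, neg_zero]

end IsParaSasakiLike
end ApcpcrStructure

end ParaSasakiLike

/-! ### Integral curves and geodesics -/

section Geodesics

variable {E : Type*} [NormedAddCommGroup E] [NormedSpace ℝ E]
  {H : Type*} [TopologicalSpace H] {I : ModelWithCorners ℝ E H}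
  {M : Type*} [TopologicalSpace M] [ChartedSpace H M] [IsManifold I ∞ M]

/-- The coordinates of a vector field in the trivialization of the tangent bundle at `p`. Outside of
the domain of the trivialization they are `0`, which makes them linear in the vector field
everywhere. -/
def trivCoord (p : M) (Y : Π q : M, TangentSpace I q) (q : M) : E :=
  (trivializationAt E (TangentSpace I) p).continuousLinearMapAt ℝ q (Y q)

lemma eventually_mem_baseSet (p : M) :
    ∀ᶠ q in nhds p, q ∈ (trivializationAt E (TangentSpace I) p).baseSet :=
  (trivializationAt E (TangentSpace I) p).open_baseSet.mem_nhds
    (FiberBundle.mem_baseSet_trivializationAt' p)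

lemma trivCoord_of_mem {p q : M} (hq : q ∈ (trivializationAt E (TangentSpace I) p).baseSet)
    (Y : Π q : M, TangentSpace I q) :
    trivCoord p Y q = (trivializationAt E (TangentSpace I) p ⟨q, Y q⟩).2 := by
  rw [trivCoord, Bundle.Trivialization.continuousLinearMapAt_apply,
    Bundle.Trivialization.coe_linearMapAt_of_mem _ hq]

lemma mdiffAt_trivCoord {p : M} {Y : Π q : M, TangentSpace I q} (hY : MDiffAt (T% Y) p) :
    MDiffAt (trivCoord p Y) p := by
  refine MDifferentiableAt.congr_of_eventuallyEq
    ((mdifferentiableAt_section I Y).1 hY) ?_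
  filter_upwards [eventually_mem_baseSet (I := I) p] with q hq using trivCoord_of_mem hq Y

lemma trivCoord_symm_self {p : M} (v : TangentSpace I p) :
    (trivializationAt E (TangentSpace I) p).symmL ℝ p
      ((trivializationAt E (TangentSpace I) p).continuousLinearMapAt ℝ p v) = v :=
  Bundle.Trivialization.symmL_continuousLinearMapAt _
    (FiberBundle.mem_baseSet_trivializationAt' p) v

variable [RiemannianBundle (fun p : M ↦ TangentSpace I p)]
  [FiniteDimensional ℝ E]
  [IsContMDiffRiemannianBundle I ∞ E (fun p : M ↦ TangentSpace I p)]

/-- `∇_u` and the derivative of coordinates satisfy the same Leibniz rule, so their difference is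
tensorial. -/
lemma tensorialAt_leviCivita_sub (p : M) (u : TangentSpace I p) :
    TensorialAt I E (fun Y : Π q : M, TangentSpace I q ↦ leviCivita I Y p u
      - (trivializationAt E (TangentSpace I) p).symmL ℝ p (mvfderiv I (trivCoord p Y) p u)) p where
  smul {f Y} hf hY := by
    have e : trivCoord p (f • Y) = f • trivCoord p Y := by
      funext q; simp only [trivCoord, Pi.smul_apply', map_smul]
    rw [e, mvfderiv_smul hf (mdiffAt_trivCoord hY),
      (leviCivita I).isCovariantDerivativeOn.leibniz (s := Set.univ) hY hf]
    simp only [add_apply, smul_apply, ContinuousLinearMap.smulRight_apply, map_add, map_smul,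
      smul_sub]
    rw [trivCoord, trivCoord_symm_self]
    abel
  add {Y Y'} hY hY' := by
    have e : trivCoord p (Y + Y') = trivCoord p Y + trivCoord p Y' := by
      funext q; simp only [trivCoord, Pi.add_apply, map_add]
    rw [e, mvfderiv_add (mdiffAt_trivCoord hY) (mdiffAt_trivCoord hY'),
      (leviCivita I).isCovariantDerivativeOn.add (s := Set.univ) hY hY']
    simp only [add_apply, map_add]
    abel

/-- The covariant derivative of a vector field in the direction `u` is the derivative of its
coordinates plus the derivative of the field with frozen coordinates. -/
lemma leviCivita_eq_add {p : M} {Y : Π q : M, TangentSpace I q} (hY : MDiffAt (T% Y) p)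
    (u : TangentSpace I p) :
    leviCivita I Y p u
      = (trivializationAt E (TangentSpace I) p).symm p (mvfderiv I (trivCoord p Y) p u)
        + leviCivita I (FiberBundle.extend E (Y p)) p u := by
  have hX := FiberBundle.mdifferentiableAt_extend (I := I) E (V := fun q : M ↦ TangentSpace I q)
    (Y p)
  have h := (tensorialAt_leviCivita_sub p u).pointwise hY hX (by simp)
  have h0 : mvfderiv I (trivCoord p (FiberBundle.extend E (Y p))) p u = 0 := by
    have hc : trivCoord p (FiberBundle.extend E (Y p))
        =ᶠ[nhds p] fun _ ↦ (trivializationAt E (TangentSpace I) p ⟨p, Y p⟩).2 := by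
      filter_upwards [eventually_mem_baseSet (I := I) p] with q hq
      rw [trivCoord_of_mem hq, FiberBundle.extend,
        Bundle.Trivialization.apply_mk_symm _ hq]
    have h1 : mfderiv I 𝓘(ℝ, E) (trivCoord p (FiberBundle.extend E (Y p))) p = 0 := by
      exact ((hasMFDerivAt_const (I := I) (I' := 𝓘(ℝ, E)) _ p).congr_of_eventuallyEq hc).mfderiv
    rw [mvfderiv, h1, ContinuousLinearMap.comp_zero]
    rfl
  rw [h0, map_zero, sub_zero, sub_eq_iff_eq_add] at h
  rw [h, add_comm, Bundle.Trivialization.symmL_apply _ (FiberBundle.mem_baseSet_trivializationAt' p)]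

/-- Along an integral curve of `X` the velocity is the restriction of `X`, so the acceleration is
`∇_X X`. -/
lemma isGeodesicOn_of_isMIntegralCurveOn {X : Π q : M, TangentSpace I q} (hX : IsSmoothField I X)
    (h0 : ∀ p, leviCivita I X p (X p) = 0) {γ : ℝ → M} {s : Set ℝ} (hs : IsOpen s)
    (hγ : IsMIntegralCurveOn γ X s) : IsGeodesicOn I γ s := by
  have hder : ∀ t ∈ s, HasMFDerivAt 𝓘(ℝ, ℝ) I γ t ((1 : ℝ →L[ℝ] ℝ).smulRight (X (γ t))) :=
    fun t ht ↦ (hγ t ht).hasMFDerivAt (hs.mem_nhds ht)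
  have hvel : ∀ t ∈ s, velocity I γ t = X (γ t) := fun t ht ↦ by
    rw [velocity, (hder t ht).mfderiv]
    exact one_smul ℝ (X (γ t))
  intro t ht
  have hd := (hder t ht).mdifferentiableAt
  have hev : ∀ᶠ r in nhds t, velocity I γ r = X (γ r) :=
    Filter.eventually_of_mem (hs.mem_nhds ht) hvel
  refine ⟨?_, ?_⟩
  · refine ((hX.mdiffAt (γ t)).comp t hd).congr_of_eventuallyEq ?_
    filter_upwards [hev] with r hr
    simp [hr]
  · have e : deriv (fun r ↦ (trivializationAt E (TangentSpace I) (γ t)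
        ⟨γ r, velocity I γ r⟩).2) t = mvfderiv I (trivCoord (γ t) X) (γ t) (X (γ t)) := by
      have hc : (fun r ↦ (trivializationAt E (TangentSpace I) (γ t) ⟨γ r, velocity I γ r⟩).2)
          =ᶠ[nhds t] trivCoord (γ t) X ∘ γ := by
        filter_upwards [hev, hd.continuousAt.eventually (eventually_mem_baseSet (I := I) (γ t))]
          with r hr hr'
        rw [hr, Function.comp_apply, trivCoord_of_mem hr']
      have hcomp := mfderiv_comp_apply (I := 𝓘(ℝ, ℝ)) (I' := I) (I'' := 𝓘(ℝ, E)) t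
        (mdiffAt_trivCoord (hX.mdiffAt (γ t))) hd (1 : ℝ)
      rw [hc.deriv_eq, ← hvel t ht]
      refine Eq.trans ?_ hcomp
      rw [← fderiv_apply_one_eq_deriv, mfderiv_eq_fderiv]
      rfl
    rw [covDerivAlong, e, hvel t ht, ← leviCivita_eq_add (hX.mdiffAt _), h0]

end Geodesics

/-! ### Lie brackets on a product of manifolds -/

section ProductFields

lemma inverse_prodMap {E₁ E₂ F₁ F₂ : Type*} [TopologicalSpace E₁] [AddCommGroup E₁] [Module ℝ E₁]
    [TopologicalSpace E₂] [AddCommGroup E₂] [Module ℝ E₂]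
    [TopologicalSpace F₁] [AddCommGroup F₁] [Module ℝ F₁]
    [TopologicalSpace F₂] [AddCommGroup F₂] [Module ℝ F₂]
    {A : E₁ →L[ℝ] F₁} {B : E₂ →L[ℝ] F₂} (hA : A.IsInvertible) (hB : B.IsInvertible) :
    (A.prodMap B).inverse = A.inverse.prodMap B.inverse := by
  obtain ⟨a, rfl⟩ := hA
  obtain ⟨b, rfl⟩ := hB
  refine ContinuousLinearMap.inverse_eq ?_ ?_ <;> ext <;> simp

lemma lieBracketWithin_prodMap {E E' : Type*} [NormedAddCommGroup E] [NormedSpace ℝ E]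
    [NormedAddCommGroup E'] [NormedSpace ℝ E'] {V W : E → E} {V' W' : E' → E'} {s : Set E}
    {t : Set E'} {z : E × E'} (hs : UniqueDiffWithinAt ℝ s z.1) (ht : UniqueDiffWithinAt ℝ t z.2)
    (hV : DifferentiableWithinAt ℝ V s z.1) (hW : DifferentiableWithinAt ℝ W s z.1)
    (hV' : DifferentiableWithinAt ℝ V' t z.2) (hW' : DifferentiableWithinAt ℝ W' t z.2) :
    lieBracketWithin ℝ (Prod.map V V') (Prod.map W W') (s ×ˢ t) z
      = (lieBracketWithin ℝ V W s z.1, lieBracketWithin ℝ V' W' t z.2) := by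
  have key : ∀ {U : E → E} {U' : E' → E'}, DifferentiableWithinAt ℝ U s z.1 →
      DifferentiableWithinAt ℝ U' t z.2 →
      fderivWithin ℝ (Prod.map U U') (s ×ˢ t) z
        = (fderivWithin ℝ U s z.1).prodMap (fderivWithin ℝ U' t z.2) := fun hU hU' ↦
    (HasFDerivWithinAt.prodMap z (hU.hasFDerivWithinAt.mono (Set.fst_image_prod_subset _ _))
      (hU'.hasFDerivWithinAt.mono (Set.snd_image_prod_subset _ _))).fderivWithin (hs.prod ht)
  simp only [lieBracketWithin, key hV hV', key hW hW']
  rfl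

variable {E : Type*} [NormedAddCommGroup E] [NormedSpace ℝ E]
  {H : Type*} [TopologicalSpace H] {I : ModelWithCorners ℝ E H}
  {M : Type*} [TopologicalSpace M] [ChartedSpace H M]
  {E' : Type*} [NormedAddCommGroup E'] [NormedSpace ℝ E']
  {H' : Type*} [TopologicalSpace H'] {I' : ModelWithCorners ℝ E' H'}
  {M' : Type*} [TopologicalSpace M'] [ChartedSpace H' M']

/-- The vector field `(X, X')` on a product of manifolds. -/
def prodField (X : Π p : M, TangentSpace I p) (X' : Π p : M', TangentSpace I' p) (q : M × M') :
    TangentSpace (I.prod I') q :=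
  letI v : E × E' := (X q.1, X' q.2)
  v

variable [IsManifold I ∞ M] [IsManifold I' ∞ M']

/-- In the product chart, a product field is read as the product of the coordinate expressions. -/
lemma mpullbackWithin_prodField (X : Π p : M, TangentSpace I p) (X' : Π p : M', TangentSpace I' p)
    (q : M × M') {z : E × E'} (hz : z.1 ∈ (extChartAt I q.1).target)
    (hz' : z.2 ∈ (extChartAt I' q.2).target) :
    mpullbackWithin 𝓘(ℝ, E × E') (I.prod I') (extChartAt (I.prod I') q).symm (prodField X X')
        (Set.range (I.prod I')) z
      = (mpullbackWithin 𝓘(ℝ, E) I (extChartAt I q.1).symm X (Set.range I) z.1,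
          mpullbackWithin 𝓘(ℝ, E') I' (extChartAt I' q.2).symm X' (Set.range I') z.2) := by
  have h1 := isInvertible_mfderivWithin_extChartAt_symm (I := I) hz
  have h2 := isInvertible_mfderivWithin_extChartAt_symm (I := I') hz'
  have d1 := mdifferentiableWithinAt_of_isInvertible_mfderivWithin h1
  have d2 := mdifferentiableWithinAt_of_isInvertible_mfderivWithin h2
  have h3 := mfderivWithin_prodMap (p := z) d1 d2
    (I.uniqueMDiffOn _ (extChartAt_target_subset_range _ hz))
    (I'.uniqueMDiffOn _ (extChartAt_target_subset_range _ hz'))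
  rw [← modelWithCornersSelf_prod, chartedSpaceSelf_prod] at h3
  have e : ⇑(extChartAt (I.prod I') q).symm
      = Prod.map (extChartAt I q.1).symm (extChartAt I' q.2).symm := by
    rw [extChartAt_prod]; rfl
  rw [e, ModelWithCorners.range_prod, mpullbackWithin, h3]
  exact congrArg (fun A : E × E' →L[ℝ] E × E' ↦ A (X _, X' _)) (inverse_prodMap h1 h2)

lemma mfderiv_extChartAt_prod (q : M × M') :
    mfderiv (I.prod I') 𝓘(ℝ, E × E') (extChartAt (I.prod I') q) q
      = (mfderiv I 𝓘(ℝ, E) (extChartAt I q.1) q.1).prodMap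
          (mfderiv I' 𝓘(ℝ, E') (extChartAt I' q.2) q.2) := by
  have d1 := mdifferentiableAt_extChartAt (I := I) (mem_chart_source H q.1)
  have d2 := mdifferentiableAt_extChartAt (I := I') (mem_chart_source H' q.2)
  have h3 := mfderiv_prodMap (p := q) d1 d2
  rw [← modelWithCornersSelf_prod, chartedSpaceSelf_prod] at h3
  have e : ⇑(extChartAt (I.prod I') q) = Prod.map (extChartAt I q.1) (extChartAt I' q.2) := by
    rw [extChartAt_prod]; rfl
  rw [← h3, e]

/-- The Lie bracket in a product is computed componentwise. -/
lemma mlieBracket_prodField [CompleteSpace E] [CompleteSpace E'] {X Y : Π p : M, TangentSpace I p}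
    {X' Y' : Π p : M', TangentSpace I' p} {q : M × M'}
    (hX : MDiffAt (T% X) q.1) (hY : MDiffAt (T% Y) q.1)
    (hX' : MDiffAt (T% X') q.2) (hY' : MDiffAt (T% Y') q.2) :
    mlieBracket (I.prod I') (prodField X X') (prodField Y Y') q
      = prodField (mlieBracket I X Y) (mlieBracket I' X' Y') q := by
  have hdiff : ∀ {Z : Π p : M, TangentSpace I p}, MDiffAt (T% Z) q.1 → DifferentiableWithinAt ℝ
      (mpullbackWithin 𝓘(ℝ, E) I (extChartAt I q.1).symm Z (Set.range I)) (Set.range I)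
      (extChartAt I q.1 q.1) := fun {Z} hZ ↦ by
    have := hZ.mdifferentiableWithinAt (s := Set.univ)
      |>.differentiableWithinAt_mpullbackWithin_vectorField
    simpa using this
  have hdiff' : ∀ {Z : Π p : M', TangentSpace I' p}, MDiffAt (T% Z) q.2 → DifferentiableWithinAt ℝ
      (mpullbackWithin 𝓘(ℝ, E') I' (extChartAt I' q.2).symm Z (Set.range I')) (Set.range I')
      (extChartAt I' q.2 q.2) := fun {Z} hZ ↦ by
    have := hZ.mdifferentiableWithinAt (s := Set.univ)
      |>.differentiableWithinAt_mpullbackWithin_vectorField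
    simpa using this
  have hev : ∀ (Z : Π p : M, TangentSpace I p) (Z' : Π p : M', TangentSpace I' p),
      mpullbackWithin 𝓘(ℝ, E × E') (I.prod I') (extChartAt (I.prod I') q).symm (prodField Z Z')
        (Set.range (I.prod I'))
      =ᶠ[nhdsWithin (extChartAt (I.prod I') q q) (Set.range I ×ˢ Set.range I')]
      Prod.map (mpullbackWithin 𝓘(ℝ, E) I (extChartAt I q.1).symm Z (Set.range I))
        (mpullbackWithin 𝓘(ℝ, E') I' (extChartAt I' q.2).symm Z' (Set.range I')) := by
    intro Z Z'
    have := extChartAt_target_mem_nhdsWithin (I := I.prod I') q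
    rw [ModelWithCorners.range_prod] at this
    filter_upwards [this] with z hz
    rw [extChartAt_prod] at hz
    exact mpullbackWithin_prodField Z Z' q hz.1 hz.2
  have hmem : extChartAt (I.prod I') q q ∈ Set.range I ×ˢ Set.range I' := by
    rw [← ModelWithCorners.range_prod]
    exact extChartAt_target_subset_range _ (mem_extChartAt_target q)
  have e : extChartAt (I.prod I') q q = (extChartAt I q.1 q.1, extChartAt I' q.2 q.2) := by
    rw [extChartAt_prod]; rfl
  have hL := Filter.EventuallyEq.lieBracketWithin_vectorField_eq_of_mem (𝕜 := ℝ)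
    (hev X X') (hev Y Y') hmem
  have hP := lieBracketWithin_prodMap (z := (extChartAt I q.1 q.1, extChartAt I' q.2 q.2))
    (I.uniqueDiffOn _ hmem.1) (I'.uniqueDiffOn _ hmem.2) (hdiff hX) (hdiff hY) (hdiff' hX')
    (hdiff' hY')
  replace hL := hL.trans ((congrArg (lieBracketWithin ℝ _ _ _) e).trans hP)
  have hinv := inverse_prodMap
    (isInvertible_mfderiv_extChartAt (I := I) (mem_extChartAt_source q.1))
    (isInvertible_mfderiv_extChartAt (I := I') (mem_extChartAt_source q.2))
  rw [← mlieBracketWithin_univ, mlieBracketWithin_apply, Set.preimage_univ, Set.univ_inter,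
    mfderiv_extChartAt_prod]
  rw [← ModelWithCorners.range_prod] at hL
  refine (congrArg₂ (fun (A : E × E' →L[ℝ] E × E') (v : E × E') ↦ A v) hinv hL).trans ?_
  rw [prodField, ← mlieBracketWithin_univ, ← mlieBracketWithin_univ, mlieBracketWithin_apply,
    mlieBracketWithin_apply, Set.preimage_univ, Set.preimage_univ, Set.univ_inter, Set.univ_inter]
  rfl

end ProductFields

/-! ### The Nijenhuis torsion, sections over products, and the half line -/

section Torsion

variable {E : Type*} [NormedAddCommGroup E] [NormedSpace ℝ E] [FiniteDimensional ℝ E]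
  {H : Type*} [TopologicalSpace H] {I : ModelWithCorners ℝ E H}
  {M : Type*} [TopologicalSpace M] [ChartedSpace H M] [IsManifold I ∞ M]

lemma nijenhuisTorsion_swap (P : Π p : M, TangentSpace I p →L[ℝ] TangentSpace I p)
    (X Y : Π p : M, TangentSpace I p) (p : M) :
    nijenhuisTorsion I P X Y p = - nijenhuisTorsion I P Y X p := by
  simp only [nijenhuisTorsion]
  rw [mlieBracket_swap_apply (V := X), mlieBracket_swap_apply (V := X),
    mlieBracket_swap_apply (V := fun q ↦ P q (X q)),
    mlieBracket_swap_apply (V := fun q ↦ P q (X q))]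
  simp only [map_neg]
  abel

lemma nijenhuisTorsion_tensorial {P : Π p : M, TangentSpace I p →L[ℝ] TangentSpace I p} {p : M}
    (hP : ∀ X : Π p : M, TangentSpace I p, MDiffAt (T% X) p → MDiffAt (T% (fun q ↦ P q (X q))) p)
    (Y : Π p : M, TangentSpace I p) :
    TensorialAt I E (fun X ↦ nijenhuisTorsion I P X Y p) p where
  smul {f X} hf hX := by
    have e : (fun q ↦ P q ((f • X) q)) = f • fun q ↦ P q (X q) := by
      funext q; simp
    simp only [nijenhuisTorsion, e, mlieBracket_smul_left hf hX, mlieBracket_smul_left hf (hP X hX),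
      map_add, map_smul, smul_sub, smul_add]
    module
  add {X X'} hX hX' := by
    have e : (fun q ↦ P q ((X + X') q)) = (fun q ↦ P q (X q)) + fun q ↦ P q (X' q) := by
      funext q; simp
    simp only [nijenhuisTorsion, e, mlieBracket_add_left hX hX',
      mlieBracket_add_left (hP X hX) (hP X' hX'), map_add]
    abel

lemma mlieBracket_add_smul_left {A B D : Π p : M, TangentSpace I p} {u : M → ℝ} {p : M}
    (hA : MDiffAt (T% A) p) (hD : MDiffAt (T% D) p) (hu : MDiffAt u p) :
    mlieBracket I (A + u • D) B p
      = mlieBracket I A B p + u p • mlieBracket I D B p - mvfderiv I u p (B p) • D p := by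
  rw [mlieBracket_add_left hA (hu.smul_section hD), mlieBracket_smul_left hu hD]
  module

lemma mlieBracket_add_smul_right {A B D : Π p : M, TangentSpace I p} {u : M → ℝ} {p : M}
    (hA : MDiffAt (T% A) p) (hD : MDiffAt (T% D) p) (hu : MDiffAt u p) :
    mlieBracket I B (A + u • D) p
      = mlieBracket I B A p + u p • mlieBracket I B D p + mvfderiv I u p (B p) • D p := by
  rw [mlieBracket_add_right hA (hu.smul_section hD), mlieBracket_smul_right hu hD]
  module

end Torsion

section ProductSections

variable {E : Type*} [NormedAddCommGroup E] [NormedSpace ℝ E]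
  {H : Type*} [TopologicalSpace H] {I : ModelWithCorners ℝ E H}
  {M : Type*} [TopologicalSpace M] [ChartedSpace H M] [IsManifold I ∞ M]
  {E' : Type*} [NormedAddCommGroup E'] [NormedSpace ℝ E']
  {H' : Type*} [TopologicalSpace H'] {I' : ModelWithCorners ℝ E' H'}
  {M' : Type*} [TopologicalSpace M'] [ChartedSpace H' M'] [IsManifold I' ∞ M']

lemma mdiffAt_pair {v : Π q : M × M', TangentSpace I q.1} {w : Π q : M × M', TangentSpace I' q.2}
    {q : M × M'}
    (hv : MDifferentiableAt (I.prod I') I.tangent (fun q ↦ (⟨q.1, v q⟩ : TangentBundle I M)) q)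
    (hw : MDifferentiableAt (I.prod I') I'.tangent (fun q ↦ (⟨q.2, w q⟩ : TangentBundle I' M')) q) :
    MDifferentiableAt (I.prod I') (I.prod I').tangent
      (fun q ↦ (⟨q, (v q, w q)⟩ : TangentBundle (I.prod I') (M × M'))) q :=
  ((contMDiff_equivTangentBundleProd_symm (n := 1) (I := I) (I' := I') (M := M) (M' := M')
    _).mdifferentiableAt one_ne_zero).comp q (hv.prodMk hw)

lemma mdiffAt_fst_component {V : Π q : M × M', TangentSpace (I.prod I') q} {q : M × M'}
    (hV : MDiffAt (T% V) q) :
    MDifferentiableAt (I.prod I') I.tangent (fun q ↦ (⟨q.1, (V q).1⟩ : TangentBundle I M)) q :=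
  (((contMDiff_fst.comp (contMDiff_equivTangentBundleProd (n := 1) (I := I) (I' := I') (M := M)
    (M' := M'))) _).mdifferentiableAt one_ne_zero).comp q hV

lemma mdiffAt_snd_component {V : Π q : M × M', TangentSpace (I.prod I') q} {q : M × M'}
    (hV : MDiffAt (T% V) q) :
    MDifferentiableAt (I.prod I') I'.tangent (fun q ↦ (⟨q.2, (V q).2⟩ : TangentBundle I' M')) q :=
  (((contMDiff_snd.comp (contMDiff_equivTangentBundleProd (n := 1) (I := I) (I' := I') (M := M)
    (M' := M'))) _).mdifferentiableAt one_ne_zero).comp q hV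

lemma mdiffAt_prodField {X : Π p : M, TangentSpace I p} {X' : Π p : M', TangentSpace I' p}
    {q : M × M'} (hX : MDiffAt (T% X) q.1) (hX' : MDiffAt (T% X') q.2) :
    MDiffAt (T% (prodField X X')) q :=
  mdiffAt_pair (hX.comp q mdifferentiableAt_fst) (hX'.comp q mdifferentiableAt_snd)

end ProductSections

section PosReals

/-- All charts of `ℝ⁺`, an open subset of the line, coincide, so the trivializations of its tangent
bundle do not change the vector. -/
lemma trivializationAt_posReals (r : posReals) (z : TangentBundle 𝓘(ℝ, ℝ) posReals) :
    (trivializationAt ℝ (TangentSpace 𝓘(ℝ, ℝ)) r z).2 = z.2 :=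
  (tangentBundleCore 𝓘(ℝ, ℝ) posReals).coordChange_self (achart ℝ z.1) z.1
    (mem_chart_source ℝ z.1) z.2

/-- The vector field `∂_r` of the half line. -/
def radial (r : posReals) : TangentSpace 𝓘(ℝ, ℝ) r :=
  letI one : ℝ := 1
  one

lemma mdiffAt_radial (r : posReals) : MDiffAt (T% radial) r := by
  rw [mdifferentiableAt_section]
  simp only [trivializationAt_posReals]
  exact mdifferentiableAt_const

lemma hasMFDerivAt_coe (r : posReals) :
    HasMFDerivAt 𝓘(ℝ, ℝ) 𝓘(ℝ, ℝ) (fun r : posReals ↦ (r : ℝ)) r (ContinuousLinearMap.id ℝ ℝ) := by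
  refine ⟨continuous_subtype_val.continuousAt, ?_⟩
  refine (hasFDerivWithinAt_id _ _).congr_of_eventuallyEq ?_
    ((extChartAt 𝓘(ℝ, ℝ) r).right_inv (mem_extChartAt_target r))
  filter_upwards [extChartAt_target_mem_nhdsWithin (I := 𝓘(ℝ, ℝ)) r] with x hx
  exact (extChartAt 𝓘(ℝ, ℝ) r).right_inv hx

end PosReals

/-! ### The cone `M × ℝ⁺` -/

section Cone

variable {E : Type*} [NormedAddCommGroup E] [NormedSpace ℝ E]
  {H : Type*} [TopologicalSpace H] {I : ModelWithCorners ℝ E H}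
  {M : Type*} [TopologicalSpace M] [ChartedSpace H M] [IsManifold I ∞ M]

/-- The vector field on `M × ℝ⁺` that is `X` on every slice. -/
def coneLift (X : Π p : M, TangentSpace I p) :
    Π q : M × posReals, TangentSpace (I.prod 𝓘(ℝ, ℝ)) q :=
  prodField X 0

variable (I M) in
/-- The vector field `∂_r` on `M × ℝ⁺`. -/
def coneRadial : Π q : M × posReals, TangentSpace (I.prod 𝓘(ℝ, ℝ)) q :=
  prodField 0 radial

variable (M) in
/-- The function `r` on `M × ℝ⁺`. -/
def coneRadius (q : M × posReals) : ℝ := q.2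

/-- The component along `M` of a tangent vector of `M × ℝ⁺`. -/
def coneFst (q : M × posReals) : TangentSpace (I.prod 𝓘(ℝ, ℝ)) q →ₗ[ℝ] TangentSpace I q.1 :=
  LinearMap.fst ℝ E ℝ

/-- The coefficient of `∂_r` of a tangent vector of `M × ℝ⁺`. -/
def coneSnd (q : M × posReals) : TangentSpace (I.prod 𝓘(ℝ, ℝ)) q →ₗ[ℝ] ℝ :=
  LinearMap.snd ℝ E ℝ

lemma cone_ext {q : M × posReals} {v w : TangentSpace (I.prod 𝓘(ℝ, ℝ)) q}
    (h1 : coneFst q v = coneFst q w) (h2 : coneSnd q v = coneSnd q w) : v = w :=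
  Prod.ext h1 h2

lemma coneFst_coneLift (X : Π p : M, TangentSpace I p) (q : M × posReals) :
    coneFst q (coneLift X q) = X q.1 := rfl

lemma coneSnd_coneLift (X : Π p : M, TangentSpace I p) (q : M × posReals) :
    coneSnd q (coneLift X q) = 0 := rfl

lemma coneFst_coneRadial (q : M × posReals) : coneFst q (coneRadial I M q) = 0 := rfl

lemma coneSnd_coneRadial (q : M × posReals) : coneSnd q (coneRadial I M q) = 1 := rfl

lemma coneRadius_ne_zero (q : M × posReals) : coneRadius M q ≠ 0 := ne_of_gt q.2.2

lemma mdiffAt_zeroField (p : M) : MDiffAt (T% (0 : Π p : M, TangentSpace I p)) p :=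
  mdifferentiableAt_zeroSection ..

lemma mdiffAt_coneLift {X : Π p : M, TangentSpace I p} {q : M × posReals}
    (hX : MDiffAt (T% X) q.1) : MDiffAt (T% (coneLift X)) q :=
  mdiffAt_prodField hX (mdiffAt_zeroField q.2)

lemma mdiffAt_coneRadial (q : M × posReals) : MDiffAt (T% (coneRadial I M)) q :=
  mdiffAt_prodField (mdiffAt_zeroField q.1) (mdiffAt_radial q.2)

lemma hasMFDerivAt_coneRadius (q : M × posReals) :
    HasMFDerivAt (I.prod 𝓘(ℝ, ℝ)) 𝓘(ℝ, ℝ) (coneRadius M) q (ContinuousLinearMap.snd ℝ E ℝ) :=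
  (hasMFDerivAt_coe q.2).comp q (hasMFDerivAt_snd q)

lemma mdiffAt_coneRadius (q : M × posReals) :
    MDifferentiableAt (I.prod 𝓘(ℝ, ℝ)) 𝓘(ℝ, ℝ) (coneRadius M) q :=
  (hasMFDerivAt_coneRadius q).mdifferentiableAt

lemma mvfderiv_coneRadius (q : M × posReals) (v : TangentSpace (I.prod 𝓘(ℝ, ℝ)) q) :
    mvfderiv (I.prod 𝓘(ℝ, ℝ)) (coneRadius M) q v = coneSnd q v := by
  rw [mvfderiv, (hasMFDerivAt_coneRadius q).mfderiv]
  rfl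

lemma hasMFDerivAt_coneRadius_inv (q : M × posReals) :
    HasMFDerivAt (I.prod 𝓘(ℝ, ℝ)) 𝓘(ℝ, ℝ) (fun q ↦ (coneRadius M q)⁻¹) q
      ((-(coneRadius M q ^ 2)⁻¹) • ContinuousLinearMap.snd ℝ E ℝ) := by
  have h := (hasDerivAt_inv (coneRadius_ne_zero q)).hasFDerivAt.hasMFDerivAt.comp q
    (hasMFDerivAt_coneRadius (I := I) q)
  have e : (ContinuousLinearMap.toSpanSingleton ℝ (-(coneRadius M q ^ 2)⁻¹)).comp
      (ContinuousLinearMap.snd ℝ E ℝ)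
      = (-(coneRadius M q ^ 2)⁻¹) • ContinuousLinearMap.snd ℝ E ℝ := by
    ext v <;> simp
  rw [← e]
  exact h

lemma mvfderiv_coneRadius_inv (q : M × posReals) (v : TangentSpace (I.prod 𝓘(ℝ, ℝ)) q) :
    mvfderiv (I.prod 𝓘(ℝ, ℝ)) (fun q ↦ (coneRadius M q)⁻¹) q v = 
      -(coneRadius M q ^ 2)⁻¹ * coneSnd q v := by
  rw [mvfderiv, (hasMFDerivAt_coneRadius_inv q).mfderiv]
  rfl

lemma mvfderiv_comp_fst {f : M → ℝ} {q : M × posReals} (hf : MDiffAt f q.1)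
    (v : TangentSpace (I.prod 𝓘(ℝ, ℝ)) q) :
    mvfderiv (I.prod 𝓘(ℝ, ℝ)) (fun q ↦ f q.1) q v = mvfderiv I f q.1 (coneFst q v) := by
  have h := hf.hasMFDerivAt.comp q (hasMFDerivAt_fst (I := I) (I' := 𝓘(ℝ, ℝ)) q)
  rw [mvfderiv, mvfderiv]
  exact congrArg (fun A : E × ℝ →L[ℝ] ℝ ↦ A v) h.mfderiv

variable [FiniteDimensional ℝ E]

lemma mlieBracket_coneLift {X Y : Π p : M, TangentSpace I p} {q : M × posReals}
    (hX : MDiffAt (T% X) q.1) (hY : MDiffAt (T% Y) q.1) :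
    mlieBracket (I.prod 𝓘(ℝ, ℝ)) (coneLift X) (coneLift Y) q = coneLift (mlieBracket I X Y) q := by
  have : CompleteSpace E := FiniteDimensional.complete ℝ E
  rw [coneLift, coneLift, mlieBracket_prodField hX hY (mdiffAt_zeroField _) (mdiffAt_zeroField _),
    mlieBracket_zero_left, coneLift]

lemma mlieBracket_coneLift_coneRadial {X : Π p : M, TangentSpace I p} {q : M × posReals}
    (hX : MDiffAt (T% X) q.1) :
    mlieBracket (I.prod 𝓘(ℝ, ℝ)) (coneLift X) (coneRadial I M) q = 0 := by
  have : CompleteSpace E := FiniteDimensional.complete ℝ E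
  rw [coneLift, coneRadial, mlieBracket_prodField hX (mdiffAt_zeroField _) (mdiffAt_zeroField _)
    (mdiffAt_radial _), mlieBracket_zero_left, mlieBracket_zero_right]
  rfl

variable [RiemannianBundle (fun p : M ↦ TangentSpace I p)]
  [IsContMDiffRiemannianBundle I ∞ E (fun p : M ↦ TangentSpace I p)]

namespace ApcpcrStructure

variable {n : ℕ} (S : ApcpcrStructure I M n)

/-- The function `r η(X)` on `M × ℝ⁺`. -/
def coneEta (X : Π p : M, TangentSpace I p) (q : M × posReals) : ℝ :=
  coneRadius M q * S.eta X q.1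

lemma mdiffAt_coneEta {X : Π p : M, TangentSpace I p} {q : M × posReals}
    (hX : MDiffAt (T% X) q.1) :
    MDifferentiableAt (I.prod 𝓘(ℝ, ℝ)) 𝓘(ℝ, ℝ) (S.coneEta X) q :=
  (mdiffAt_coneRadius q).mul ((S.mdiffAt_eta hX).comp q mdifferentiableAt_fst)

lemma mvfderiv_coneEta {X : Π p : M, TangentSpace I p} {q : M × posReals}
    (hX : MDiffAt (T% X) q.1) (v : TangentSpace (I.prod 𝓘(ℝ, ℝ)) q) :
    mvfderiv (I.prod 𝓘(ℝ, ℝ)) (S.coneEta X) q v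
      = coneRadius M q * mvfderiv I (S.eta X) q.1 (coneFst q v) + S.eta X q.1 * coneSnd q v := by
  have h := mvfderiv_mul (mdiffAt_coneRadius (I := I) q)
    ((S.mdiffAt_eta hX).comp q mdifferentiableAt_fst)
  have h2 : mvfderiv (I.prod 𝓘(ℝ, ℝ)) (S.coneEta X) q v = _ := congrArg (fun A ↦ A v) h
  rw [h2]
  simp only [add_apply, smul_apply, smul_eq_mul]
  rw [mvfderiv_coneRadius]
  exact congrArg (fun t ↦ coneRadius M q * t + S.eta X q.1 * coneSnd q v)
    (mvfderiv_comp_fst (S.mdiffAt_eta hX) v)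

lemma coneFst_cone (q : M × posReals) (v : TangentSpace (I.prod 𝓘(ℝ, ℝ)) q) :
    coneFst q (S.cone q v)
      = S.φ q.1 (coneFst q v) + ((coneRadius M q)⁻¹ * coneSnd q v) • S.ξ q.1 := rfl

lemma coneSnd_cone (q : M × posReals) (v : TangentSpace (I.prod 𝓘(ℝ, ℝ)) q) :
    coneSnd q (S.cone q v) = coneRadius M q * S.η q.1 (coneFst q v) := rfl

lemma cone_cone (q : M × posReals) (v : TangentSpace (I.prod 𝓘(ℝ, ℝ)) q) :
    S.cone q (S.cone q v) = v := by
  have hr := coneRadius_ne_zero q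
  refine cone_ext ?_ ?_
  · rw [coneFst_cone, coneFst_cone, coneSnd_cone, map_add, map_smul, S.φ_φ, S.φ_ξ,
      inv_mul_cancel_left₀ hr, smul_zero, add_zero, sub_add_cancel]
  · rw [coneSnd_cone, coneFst_cone, map_add, map_smul, S.η_φ, S.η_ξ, zero_add, smul_eq_mul,
      mul_one, mul_inv_cancel_left₀ hr]

/-- `P̌ X = φ X + r η(X) ∂_r` for the lift of `X`. -/
lemma cone_coneLift (X : Π p : M, TangentSpace I p) :
    (fun q ↦ S.cone q (coneLift X q)) = coneLift (S.phi X) + S.coneEta X • coneRadial I M := by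
  funext q
  refine cone_ext ?_ ?_
  · simp [coneFst_cone, coneFst_coneLift, coneSnd_coneLift, coneFst_coneRadial, phi]
  · simp [coneSnd_cone, coneFst_coneLift, coneSnd_coneLift, coneSnd_coneRadial, coneEta, eta]

/-- `P̌ ∂_r = r⁻¹ ξ`. -/
lemma cone_coneRadial :
    (fun q ↦ S.cone q (coneRadial I M q)) = (fun q ↦ (coneRadius M q)⁻¹) • coneLift S.ξ := by
  funext q
  refine cone_ext ?_ ?_
  · simp [coneFst_cone, coneFst_coneLift, coneSnd_coneRadial, coneFst_coneRadial]
  · simp [coneSnd_cone, coneSnd_coneLift, coneFst_coneRadial]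

lemma mdiffAt_cone {V : Π q : M × posReals, TangentSpace (I.prod 𝓘(ℝ, ℝ)) q} {q : M × posReals}
    (hV : MDiffAt (T% V) q) : MDiffAt (T% (fun q ↦ S.cone q (V q))) q := by
  have h1 := mdiffAt_fst_component hV
  have h2 := mdiffAt_snd_component hV
  have ha : MDifferentiableAt (I.prod 𝓘(ℝ, ℝ)) 𝓘(ℝ, ℝ) (fun q ↦ ((V q).2 : ℝ)) q := by
    have := ((mdifferentiableAt_totalSpace _ _).1 h2).2
    simpa only [trivializationAt_posReals] using this
  have hφ := S.mdiffAt_φ_comp mdifferentiableAt_fst h1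
  have hη := S.mdiffAt_η_comp mdifferentiableAt_fst h1
  have h0 : MDifferentiableAt (I.prod 𝓘(ℝ, ℝ)) 𝓘(ℝ, ℝ).tangent
      (fun q : M × posReals ↦ (⟨q.2, 0⟩ : TangentBundle 𝓘(ℝ, ℝ) posReals)) q :=
    (mdiffAt_zeroField q.2).comp q mdifferentiableAt_snd
  have k1 := mdiffAt_pair hφ h0
  have hr := (hasMFDerivAt_coneRadius_inv (I := I) q).mdifferentiableAt
  have k2 := (hr.mul ha).smul_section (mdiffAt_coneLift (S.mdiffAt_ξ q.1))
  have k3 := ((mdiffAt_coneRadius q).mul hη).smul_section (mdiffAt_coneRadial (I := I) q)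
  have k := mdifferentiableAt_add_section (mdifferentiableAt_add_section k1 k2) k3
  refine k.congr_of_eventuallyEq (Filter.Eventually.of_forall fun q ↦ ?_)
  have e1 : S.φ q.1 (V q).1 + ((coneRadius M q)⁻¹ * (V q).2) • S.ξ q.1
      = S.φ q.1 (V q).1 + ((coneRadius M q)⁻¹ * (V q).2) • S.ξ q.1
        + (coneRadius M q * S.η q.1 (V q).1) • (0 : TangentSpace I q.1) := by
    rw [smul_zero, add_zero]
  have e2 : coneRadius M q * S.η q.1 (V q).1 = 0 + ((coneRadius M q)⁻¹ * (V q).2) * 0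
      + (coneRadius M q * S.η q.1 (V q).1) * 1 := by
    rw [mul_zero, mul_one, zero_add, zero_add]
  exact congrArg (fun w ↦ (⟨q, w⟩ : TangentBundle (I.prod 𝓘(ℝ, ℝ)) (M × posReals)))
    (Prod.ext e1 e2)

namespace IsParaSasakiLike

variable {S} [T2Space M]

/-- `φ` is invariant under the flow of `ξ`. -/
lemma mlieBracket_phi_ξ (hS : S.IsParaSasakiLike) {X : Π p : M, TangentSpace I p} {p : M}
    (hX : MDiffAt (T% X) p) :
    mlieBracket I (S.phi X) S.ξ p = S.φ p (mlieBracket I X S.ξ p) := by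
  have hξ := S.mdiffAt_ξ p
  rw [mlieBracket_eq_sub (S.mdiffAt_phi hX) hξ, mlieBracket_eq_sub hX hξ, hS.nabla_ξ_eq,
    hS.nabla_ξ_eq, hS.nabla_phi_eq hX, S.horVec_ξ, inner_zero_left, map_sub, zero_smul, smul_zero,
    sub_zero, sub_zero]
  rfl

/-- The component of `[P̌, P̌](X, ∂_r)` along `M` is `r⁻¹ ([φ X, ξ] - φ [X, ξ])`, and the component
along `∂_r` is `dη(X, ξ)`. -/
lemma nijenhuisTorsion_cone_coneLift_coneRadial (hS : S.IsParaSasakiLike)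
    {X : Π p : M, TangentSpace I p} {q : M × posReals} (hX : MDiffAt (T% X) q.1) :
    nijenhuisTorsion (I.prod 𝓘(ℝ, ℝ)) S.cone (coneLift X) (coneRadial I M) q = 0 := by
  have hφX := S.mdiffAt_phi hX
  have hξ := S.mdiffAt_ξ q.1
  have hr := (hasMFDerivAt_coneRadius_inv (I := I) q).mdifferentiableAt
  have hη := hS.dEta_eq_zero hX hξ
  rw [nijenhuisTorsion, cone_cone, S.cone_coneLift, S.cone_coneRadial,
    mlieBracket_smul_right hr (mdiffAt_coneLift hξ), mlieBracket_smul_right hr (mdiffAt_coneLift hξ),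
    mlieBracket_add_smul_left (mdiffAt_coneLift hφX) (mdiffAt_coneRadial q) (S.mdiffAt_coneEta hX),
    mlieBracket_add_smul_left (mdiffAt_coneLift hφX) (mdiffAt_coneRadial q) (S.mdiffAt_coneEta hX),
    mlieBracket_coneLift hφX hξ, mlieBracket_coneLift hX hξ, mlieBracket_coneLift_coneRadial hX,
    mlieBracket_coneLift_coneRadial hφX, mlieBracket_self,
    mlieBracket_swap_apply (V := coneRadial I M), mlieBracket_coneLift_coneRadial hξ,
    mvfderiv_coneRadius_inv, mvfderiv_coneRadius_inv, S.mvfderiv_coneEta hX, S.mvfderiv_coneEta hX]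
  have hr0 := coneRadius_ne_zero q
  have hη1 : mvfderiv I (S.eta X) q.1 (S.ξ q.1) + S.η q.1 (mlieBracket I X S.ξ q.1) = 0 := by
    have hc : S.eta S.ξ = fun _ ↦ (1 : ℝ) := funext S.η_ξ
    rw [dEta, dirDeriv, dirDeriv, hc, mvfderiv_const, zero_apply] at hη
    linear_combination -hη
  refine cone_ext ?_ ?_
  · simp only [coneFst_cone, map_add, map_sub, map_neg, map_smul, map_zero, coneFst_coneLift,
      coneFst_coneRadial, coneSnd_coneLift, coneSnd_coneRadial, Pi.zero_apply,
      Pi.add_apply, Pi.smul_apply', smul_eq_mul, hS.mlieBracket_phi_ξ hX, S.φ_ξ, coneEta]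
    match_scalars <;> field_simp <;> ring
  · simp only [coneSnd_cone, map_add, map_sub, map_neg, map_smul, map_zero, coneFst_coneLift,
      coneFst_coneRadial, coneSnd_coneLift, coneSnd_coneRadial, Pi.zero_apply, smul_eq_mul]
    field_simp
    linear_combination (-coneRadius M q ^ 2) * hη1

/-- The component of `[P̌, P̌](X, Y)` along `M` is `N(X, Y)`, and the coefficient of `∂_r` is
`r (dη(φ X, Y) + dη(X, φ Y))`. -/
lemma nijenhuisTorsion_cone_coneLift (hS : S.IsParaSasakiLike)
    {X Y : Π p : M, TangentSpace I p} {q : M × posReals} (hX : MDiffAt (T% X) q.1)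
    (hY : MDiffAt (T% Y) q.1) :
    nijenhuisTorsion (I.prod 𝓘(ℝ, ℝ)) S.cone (coneLift X) (coneLift Y) q = 0 := by
  have hφX := S.mdiffAt_phi hX
  have hφY := S.mdiffAt_phi hY
  have hR := mdiffAt_coneRadial (I := I) q
  have hRφY : mlieBracket (I.prod 𝓘(ℝ, ℝ)) (coneRadial I M) (coneLift (S.phi Y)) q = 0 := by
    rw [mlieBracket_swap_apply, mlieBracket_coneLift_coneRadial hφY, neg_zero]
  have hRY : mlieBracket (I.prod 𝓘(ℝ, ℝ)) (coneRadial I M) (coneLift Y) q = 0 := by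
    rw [mlieBracket_swap_apply, mlieBracket_coneLift_coneRadial hY, neg_zero]
  rw [nijenhuisTorsion, cone_cone, S.cone_coneLift, S.cone_coneLift,
    mlieBracket_add_smul_right (mdiffAt_coneLift hφY) hR (S.mdiffAt_coneEta hY),
    mlieBracket_add_smul_right (mdiffAt_coneLift hφY) hR (S.mdiffAt_coneEta hY),
    mlieBracket_add_smul_left (mdiffAt_coneLift hφX) hR (S.mdiffAt_coneEta hX),
    mlieBracket_add_smul_left (mdiffAt_coneLift hφX) hR (S.mdiffAt_coneEta hX),
    mlieBracket_add_smul_left (mdiffAt_coneLift hφX) hR (S.mdiffAt_coneEta hX)]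
  rw [mlieBracket_coneLift hφX hφY, mlieBracket_coneLift hφX hY, mlieBracket_coneLift hX hφY,
    mlieBracket_coneLift hX hY, mlieBracket_coneLift_coneRadial hφX,
    mlieBracket_coneLift_coneRadial hX, mlieBracket_self, hRφY, hRY]
  have hr0 := coneRadius_ne_zero q
  have hN := hS.nijenhuis_eq_zero hX hY
  have hη1 := hS.dEta_eq_zero hφX hY
  have hη2 := hS.dEta_eq_zero hX hφY
  have hφ0 : ∀ Z, S.eta (S.phi Z) = fun _ ↦ (0 : ℝ) := fun Z ↦ funext fun p ↦ S.η_φ p (Z p)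
  rw [dEta, dirDeriv, dirDeriv, hφ0, mvfderiv_const, zero_apply] at hη1 hη2
  refine cone_ext ?_ ?_
  · rw [nijenhuis, nijenhuisTorsion, S.φ_φ, dEta, dirDeriv, dirDeriv] at hN
    simp only [coneFst_cone, map_add, map_sub, map_smul, map_zero,
      coneFst_coneLift, coneFst_coneRadial, coneSnd_coneLift, coneSnd_coneRadial, Pi.zero_apply,
      Pi.add_apply, Pi.smul_apply', S.mvfderiv_coneEta hX, S.mvfderiv_coneEta hY,
      smul_eq_mul, coneEta]
    refine Eq.trans ?_ hN
    unfold phi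
    match_scalars <;> field_simp
    ring
  · simp only [coneSnd_cone, map_add, map_sub, map_smul, map_zero,
      coneFst_coneLift, coneFst_coneRadial, coneSnd_coneLift, coneSnd_coneRadial, Pi.zero_apply,
      Pi.add_apply, Pi.smul_apply', S.mvfderiv_coneEta hX, S.mvfderiv_coneEta hY,
      smul_eq_mul, coneEta]
    linear_combination coneRadius M q * hη1 + coneRadius M q * hη2

lemma isNormal (hS : S.IsParaSasakiLike) : S.IsNormal := by
  intro X Y hX hY q
  have hP : ∀ V : Π q : M × posReals, TangentSpace (I.prod 𝓘(ℝ, ℝ)) q, MDiffAt (T% V) q →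
    MDiffAt (T% (fun q ↦ S.cone q (V q))) q := fun V hV ↦ S.mdiffAt_cone hV
  have hR := mdiffAt_coneRadial (I := I) q
  -- at `q`, every field agrees with the sum of a lift and a constant multiple of `∂_r`
  have key : ∀ V W : Π q : M × posReals, TangentSpace (I.prod 𝓘(ℝ, ℝ)) q, MDiffAt (T% V) q →
      (∀ Z : Π p : M, TangentSpace I p, MDiffAt (T% Z) q.1 →
        nijenhuisTorsion (I.prod 𝓘(ℝ, ℝ)) S.cone (coneLift Z) W q = 0) →
      nijenhuisTorsion (I.prod 𝓘(ℝ, ℝ)) S.cone (coneRadial I M) W q = 0 →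
      nijenhuisTorsion (I.prod 𝓘(ℝ, ℝ)) S.cone V W q = 0 := by
    intro V W hV h1 h2
    have hT := nijenhuisTorsion_tensorial hP W
    let u : TangentSpace I q.1 := (V q).1
    have hZ := FiberBundle.mdifferentiableAt_extend (I := I) E
      (V := fun p : M ↦ TangentSpace I p) u
    have hc : MDifferentiableAt (I.prod 𝓘(ℝ, ℝ)) 𝓘(ℝ, ℝ)
      (fun _ : M × posReals ↦ ((V q).2 : ℝ)) q := mdifferentiableAt_const
    have hs := hc.smul_section hR
    have h := hT.pointwise hV (mdifferentiableAt_add_section (mdiffAt_coneLift hZ) hs) (by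
      refine cone_ext ?_ ?_
      · simp only [Pi.add_apply, Pi.smul_apply', map_add, map_smul, coneFst_coneLift,
          coneFst_coneRadial, smul_zero, add_zero]
        exact (FiberBundle.extend_apply_self E u).symm
      · simp only [Pi.add_apply, Pi.smul_apply', map_add, map_smul, coneSnd_coneLift,
          coneSnd_coneRadial, smul_eq_mul, mul_one, zero_add]
        rfl)
    rw [h, hT.add (mdiffAt_coneLift hZ) hs, hT.smul hc hR, h1 _ hZ, h2, smul_zero, add_zero]
  have hLR : ∀ Z : Π p : M, TangentSpace I p, MDiffAt (T% Z) q.1 →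
      nijenhuisTorsion (I.prod 𝓘(ℝ, ℝ)) S.cone (coneLift Z) (coneRadial I M) q = 0 := fun Z hZ ↦
    hS.nijenhuisTorsion_cone_coneLift_coneRadial hZ
  refine key X Y (hX.mdiffAt q) (fun Z hZ ↦ ?_) ?_
  · rw [nijenhuisTorsion_swap, key Y _ (hY.mdiffAt q) (fun Z' hZ' ↦
      hS.nijenhuisTorsion_cone_coneLift hZ' hZ) ?_, neg_zero]
    rw [nijenhuisTorsion_swap, hLR Z hZ, neg_zero]
  · rw [nijenhuisTorsion_swap, key Y _ (hY.mdiffAt q) hLR ?_, neg_zero]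
    rw [nijenhuisTorsion, mlieBracket_self, mlieBracket_self, Pi.zero_apply, map_zero,
      map_zero, mlieBracket_swap_apply (V := coneRadial I M), map_neg, sub_neg_eq_add, zero_add,
      zero_sub, neg_add_cancel]

end IsParaSasakiLike
end ApcpcrStructure
end Cone

end

end ParaSasaki

theorem corollary2p3 (n : ℕ) {M : Type*} [TopologicalSpace M] [T2Space M]
    [ChartedSpace (EuclideanSpace ℝ (Fin (2 * n + 1))) M] [IsManifold (𝓡 (2 * n + 1)) ∞ M]
    [RiemannianBundle (fun p : M ↦ TangentSpace (𝓡 (2 * n + 1)) p)]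
    [IsContMDiffRiemannianBundle (𝓡 (2 * n + 1)) ∞ (EuclideanSpace ℝ (Fin (2 * n + 1)))
      (fun p : M ↦ TangentSpace (𝓡 (2 * n + 1)) p)]
    (S : ParaSasaki.ApcpcrStructure (𝓡 (2 * n + 1)) M n) (hS : S.IsParaSasakiLike) :
    -- normal, paracontact, `N = 0`
    S.IsNormal ∧ S.IsParacontact ∧
    (∀ X Y : Π p : M, TangentSpace (𝓡 (2 * n + 1)) p,
      ParaSasaki.IsSmoothField (𝓡 (2 * n + 1)) X → ParaSasaki.IsSmoothField (𝓡 (2 * n + 1)) Y →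
      ∀ p, S.nijenhuis X Y p = 0) ∧
    -- the Lie derivative of `g` along `ξ` is twice the restriction of the associated metric to `H`
    (∀ X Y : Π p : M, TangentSpace (𝓡 (2 * n + 1)) p,
      ParaSasaki.IsSmoothField (𝓡 (2 * n + 1)) X → ParaSasaki.IsSmoothField (𝓡 (2 * n + 1)) Y →
      ∀ p, S.lieDerivMetric X Y p = 2 * S.assocMetric (S.hor X) (S.hor Y) p) ∧
    -- `dη = 0`
    (∀ X Y : Π p : M, TangentSpace (𝓡 (2 * n + 1)) p,
      ParaSasaki.IsSmoothField (𝓡 (2 * n + 1)) X → ParaSasaki.IsSmoothField (𝓡 (2 * n + 1)) Y →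
      ∀ p, S.dEta X Y p = 0) ∧
    -- `∇_ξ ξ = 0`, the integral curves of `ξ` are geodesics
    (∀ p, ParaSasaki.nabla (𝓡 (2 * n + 1)) S.ξ S.ξ p = 0) ∧
    (∀ (γ : ℝ → M) (s : Set ℝ), IsOpen s → IsMIntegralCurveOn γ S.ξ s →
      ParaSasaki.IsGeodesicOn (𝓡 (2 * n + 1)) γ s) ∧
    -- `θ = -2n η` and `θ* = 0`
    (∀ (p : M) (e : Fin (2 * n) → Π q : M, TangentSpace (𝓡 (2 * n + 1)) q),
      S.IsHorizontalFrameAt e p →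
      ∀ Z : Π q : M, TangentSpace (𝓡 (2 * n + 1)) q,
        ParaSasaki.IsSmoothField (𝓡 (2 * n + 1)) Z →
        S.theta e Z p = -2 * (n : ℝ) * S.eta Z p ∧ S.thetaStar e Z p = 0) := by
  refine ⟨hS.isNormal, hS.isParacontact,
    fun X Y hX hY p ↦ hS.nijenhuis_eq_zero (hX.mdiffAt p) (hY.mdiffAt p),
    fun X Y hX hY p ↦ hS.lieDerivMetric_eq_assocMetric (hX.mdiffAt p) (hY.mdiffAt p),
    fun X Y hX hY p ↦ hS.dEta_eq_zero (hX.mdiffAt p) (hY.mdiffAt p), hS.nabla_ξ_ξ,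
    fun γ s hs hγ ↦ ParaSasaki.isGeodesicOn_of_isMIntegralCurveOn S.smooth_ξ
      (fun p ↦ hS.nabla_ξ_ξ p) hs hγ,
    fun p e he Z _ ↦ ⟨hS.theta_eq he Z, hS.thetaStar_eq_zero (by simp) he Z⟩⟩
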